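/- For a permutation $\tau$ of $[n]=\{1,\dots,n\}$, let $\mathrm{lrec}(\tau)$ be its number of low records (left-to-right minima), i.e. of positions $i\in[n]$ such that $\tau(j)>\tau(i)$ for all $j<i$. A cycle type of size $n$ is a sequence $t=(t_1,\dots,t_n)$ of nonnegative integers with $\sum_{p=1}^n p\,t_p=n$; a permutation of $[n]$ is $t$-cyclic if, for every $p$, it has exactly $t_p$ cycles of length $p$ (fixed points being the cycles of length $1$). For each $n$, let $t^{(n)}$ be a cycle type of size $n$ such that $t_1^{(n)}=O(\sqrt n)$ as $n\to\infty$, and let $\tau_n$ be a uniformly random $t^{(n)}$-cyclic permutation. 1. If $t_1^{(n)}+2t_2^{(n)}=n$ for all $n$ (that is, $\tau_n$ is a product of disjoint $2$-cycles), then, in distribution as $n\to\infty$, $$\frac{\mathrm{lrec}(\tau_n)-\log n}{\sqrt{\log n}}\longrightarrow \mathcal N(0,2).$$ 2. If $t_1^{(n)}+3t_3^{(n)}=n$ for all $n$ (that is, $\tau_n$ is a product of disjoint $3$-cycles), then, in distribution as $n\to\infty$, $$\frac{\mathrm{lrec}(\tau_n)-\log n}{\sqrt{\log n}}\longrightarrow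 \mathcal N(0,1).$$ Here $\mathcal N(0,\sigma^2)$ is the centred normal law with variance $\sigma^2$. -/

import Mathlib

open MeasureTheory ProbabilityTheory Filter Asymptotics

/-- The number of low records (left-to-right minima) of a permutation `σ`: positions `i` such
that `σ j > σ i` for every `j < i`. -/
def lrec {n : ℕ} (σ : Equiv.Perm (Fin n)) : ℕ :=
  (Finset.univ.filter fun i : Fin n => ∀ j : Fin n, j < i → σ i < σ j).card

/-- The coordinate `t_p` of a cycle type `t` of size `n`: the number of cycles of length `p`.
Cycle types of size `n` (sequences `t_1, ..., t_n` with `∑ p * t_p = n`) are encoded by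
partitions of `n`, in which the part `p` has multiplicity `t_p`. -/
def numCycles {n : ℕ} (t : n.Partition) (p : ℕ) : ℕ :=
  t.parts.count p

/-- The set of `t`-cyclic permutations: those whose cycle lengths, fixed points included
(as cycles of length one), are the parts of `t`. -/
def cyclicPerms {n : ℕ} (t : n.Partition) : Set (Equiv.Perm (Fin n)) :=
  {σ | σ.partition.parts = t.parts}

/-- The finite set of permutations carries the discrete `σ`-algebra. -/
instance permFinMeasurableSpace (n : ℕ) : MeasurableSpace (Equiv.Perm (Fin n)) := ⊤

/-- Every set of permutations is measurable. -/
instance permFinDiscreteMeasurableSpace (n : ℕ) :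
    DiscreteMeasurableSpace (Equiv.Perm (Fin n)) :=
  ⟨fun _ => trivial⟩

/-!
Fix `m` a little smaller than `√n`. With high probability `σ` maps no `i < m` to a value below
`m`. Then the low records of `σ` at the positions below `m` are the left-to-right minima of
`σ 0, …, σ (m - 1)`, those with value below `m` correspond to the left-to-right minima of
`σ⁻¹ 0, …, σ⁻¹ (m - 1)`, and the remaining ones number `o(√(log n))` in mean: both sequences meet
the values below some `L` a little larger than `√n`, so the remaining records are points of the
graph of `σ` in a square of side `L`.

The law of `σ` is invariant under relabellings that fix `0, …, m - 1`, so the relative order of the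
two sequences is uniform, and the number of minima of one of them has generating function
`∏ (x + j) / (j + 1)` over `j < m`: it is a sum of independent Bernoulli variables of mean and
variance about `log m`, that is `(log n) / 2`. If `σ` is an involution, the two sequences coincide
and the number of records is nearly twice this variable, whence the variance `2`. If `σ ^ 2` also
maps no `i < m` to a value below `m`, the two sequences are disjoint, hence independent, whence the
variance `1`.
-/

section Products

variable {R : Type*} [NormedCommRing R] [NormOneClass R]

lemma norm_prod_sub_prod_le {ι : Type*} (s : Finset ι) {a b : ι → R} (ha : ∀ i ∈ s, ‖a i‖ ≤ 1)
    (hb : ∀ i ∈ s, ‖b i‖ ≤ 1) : ‖∏ i ∈ s, a i - ∏ i ∈ s, b i‖ ≤ ∑ i ∈ s, ‖a i - b i‖ := by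
  classical
  induction s using Finset.induction_on with
  | empty => simp
  | insert i s hi ih =>
    have ha' : ‖a i‖ ≤ 1 := ha i (Finset.mem_insert_self i s)
    have hb' : ‖∏ j ∈ s, b j‖ ≤ 1 := (Finset.norm_prod_le s b).trans
      (Finset.prod_le_one (fun _ _ => norm_nonneg _) fun j hj => hb j (Finset.mem_insert_of_mem hj))
    rw [Finset.prod_insert hi, Finset.prod_insert hi, Finset.sum_insert hi]
    calc ‖a i * ∏ j ∈ s, a j - b i * ∏ j ∈ s, b j‖
        = ‖(a i - b i) * ∏ j ∈ s, b j + a i * (∏ j ∈ s, a j - ∏ j ∈ s, b j)‖ := by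
          congr 1; ring
      _ ≤ ‖a i - b i‖ * ‖∏ j ∈ s, b j‖ + ‖a i‖ * ‖∏ j ∈ s, a j - ∏ j ∈ s, b j‖ :=
          (norm_add_le _ _).trans (add_le_add (norm_mul_le _ _) (norm_mul_le _ _))
      _ ≤ ‖a i - b i‖ * 1 + 1 * ∑ j ∈ s, ‖a j - b j‖ := by
          gcongr
          exact ih (fun j hj => ha j (Finset.mem_insert_of_mem hj))
            fun j hj => hb j (Finset.mem_insert_of_mem hj)
      _ = ‖a i - b i‖ + ∑ j ∈ s, ‖a j - b j‖ := by rw [mul_one, one_mul]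

lemma norm_pow_sub_one_le {x : R} (hx : ‖x‖ ≤ 1) (k : ℕ) : ‖x ^ k - 1‖ ≤ k * ‖x - 1‖ := by
  simpa using norm_prod_sub_prod_le (Finset.range k) (a := fun _ => x) (b := fun _ => 1)
    (fun _ _ => hx) fun _ _ => norm_one.le

end Products

section Records

variable {α : Type*} [LinearOrder α] {m : ℕ}

/-- The positions of the left-to-right minima (low records) of a finite sequence. -/
def leftMinima (f : Fin m → α) : Finset (Fin m) :=
  Finset.univ.filter fun i => ∀ j < i, f i < f j

lemma card_leftMinima_succ (f : Fin (m + 1) → α) :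
    (leftMinima f).card = (leftMinima (f ∘ Fin.castSucc)).card +
      if ∀ j : Fin m, f (Fin.last m) < f j.castSucc then 1 else 0 := by
  simp only [leftMinima, Finset.card_filter, Fin.sum_univ_castSucc, Fin.forall_fin_succ',
    Fin.castSucc_lt_castSucc_iff, Fin.castSucc_lt_last, Function.comp_apply, lt_self_iff_false,
    (Fin.castSucc_lt_last _).not_gt, false_imp_iff, true_imp_iff, and_true]

lemma forall_lt_swap_none_some_iff {β : Type*} [DecidableEq β] {f : Option β → α}
    (hf : f.Injective) {k p : Option β} (hk : ∀ q, f k ≤ f q) :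
    (∀ b, f p < f (Equiv.swap none p (some b))) ↔ p = k := by
  constructor
  · intro h
    by_contra hpk
    obtain ⟨b, hb⟩ := Option.ne_none_iff_exists'.1
      (show Equiv.swap none p k ≠ none by
        rwa [Ne, Equiv.swap_apply_eq_iff, Equiv.swap_apply_left, eq_comm])
    have lt_k := h b
    rw [← hb, Equiv.swap_apply_self] at lt_k
    exact (hk p).not_gt lt_k
  · rintro rfl b
    refine (hk _).lt_of_ne (hf.ne ?_)
    rw [Ne, eq_comm, Equiv.swap_apply_eq_iff, Equiv.swap_apply_right]
    exact Option.some_ne_none _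

lemma sum_perm_fin_succ_last {M : Type*} [AddCommMonoid M] (F : Equiv.Perm (Fin (m + 1)) → M) :
    ∑ ρ, F ρ = ∑ p : Option (Fin m), ∑ e : Equiv.Perm (Fin m),
      F (finSuccEquivLast.symm.permCongr (Equiv.Perm.decomposeOption.symm (p, e))) := by
  rw [← Fintype.sum_prod_type', Equiv.sum_comp Equiv.Perm.decomposeOption.symm
    (fun σ => F (finSuccEquivLast.symm.permCongr σ)), Equiv.sum_comp]

lemma sum_pow_card_leftMinima_comp {R : Type*} [CommSemiring R] (f : Fin m → α)
    (hf : f.Injective) (x : R) :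
    ∑ ρ : Equiv.Perm (Fin m), x ^ (leftMinima (f ∘ ρ)).card = ∏ j ∈ Finset.range m, (x + j) := by
  induction m with
  | zero => simp [leftMinima]
  | succ m ih =>
    set f' : Option (Fin m) → α := f ∘ finSuccEquivLast.symm with hf'
    have f'_inj : f'.Injective := hf.comp finSuccEquivLast.symm.injective
    obtain ⟨k, hk⟩ := Finite.exists_min f'
    have card_eq (p : Option (Fin m)) (e : Equiv.Perm (Fin m)) :
        (leftMinima (f ∘ finSuccEquivLast.symm.permCongr
          (Equiv.Perm.decomposeOption.symm (p, e)))).card =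
        (leftMinima ((f' ∘ Equiv.swap none p ∘ some) ∘ e)).card + if p = k then 1 else 0 := by
      rw [card_leftMinima_succ]
      congr 1
      · congr 2
        ext j
        simp [hf']
      · refine if_congr (Iff.trans ?_
          (e.forall_congr_right.trans (forall_lt_swap_none_some_iff f'_inj hk))) rfl rfl
        simp [hf']
    have sum_inner (p : Option (Fin m)) : ∑ e : Equiv.Perm (Fin m),
        x ^ (leftMinima ((f' ∘ Equiv.swap none p ∘ some) ∘ e)).card =
          ∏ j ∈ Finset.range m, (x + j) :=
      ih _ (f'_inj.comp ((Equiv.injective _).comp (Option.some_injective _)))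
    simp_rw [sum_perm_fin_succ_last, card_eq, pow_add, ← Finset.sum_mul, sum_inner,
      ← Finset.mul_sum, Finset.prod_range_succ]
    congr 1
    rw [← Finset.add_sum_erase _ _ (Finset.mem_univ k), if_pos rfl, pow_one,
      Finset.sum_congr rfl fun p hp => by rw [if_neg (Finset.ne_of_mem_erase hp), pow_zero]]
    simp

/-- The first `m` elements of `Fin n`, which are all of them when `n ≤ m`. -/
def below (n m : ℕ) : Finset (Fin n) :=
  Finset.univ.filter fun i => (i : ℕ) < m

lemma mem_below {n : ℕ} {i : Fin n} : i ∈ below n m ↔ (i : ℕ) < m := by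
  simp [below]

lemma card_below {n : ℕ} (h : m ≤ n) : (below n m).card = m := by
  rw [below, Fin.card_filter_val_lt, min_eq_right h]

lemma card_filter_leftMinima_mem_below {n : ℕ} (h : m ≤ n) (f : Fin n → α) :
    ((leftMinima f).filter (· ∈ below n m)).card =
      (leftMinima (f ∘ Fin.castLE h)).card := by
  rw [← Finset.card_map (Fin.castLEEmb h)]
  congr 1
  ext i
  simp only [leftMinima, mem_below, Finset.mem_filter, Finset.mem_univ, true_and, Finset.mem_map]
  constructor
  · rintro ⟨hi, him⟩
    exact ⟨⟨i, him⟩, fun j hj => hi (Fin.castLE h j) hj, rfl⟩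
  · rintro ⟨k, hk, rfl⟩
    exact ⟨fun j hj => hk ⟨j, (Fin.lt_def.1 hj).trans k.2⟩ hj, k.2⟩

lemma apply_mem_leftMinima_inv {σ : Equiv.Perm (Fin m)} {i : Fin m} (hi : i ∈ leftMinima σ) :
    σ i ∈ leftMinima ⇑σ⁻¹ := by
  simp only [leftMinima, Finset.mem_filter, Finset.mem_univ, true_and] at hi ⊢
  intro j hj
  rw [Equiv.Perm.coe_inv, Equiv.symm_apply_apply]
  refine (not_lt.1 fun hlt => ?_).lt_of_ne fun heq => hj.ne ?_
  · exact (hi _ hlt).not_gt (by rwa [Equiv.apply_symm_apply])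
  · rw [heq, Equiv.apply_symm_apply]

lemma card_filter_leftMinima_apply_mem_below {k : ℕ} (σ : Equiv.Perm (Fin m)) :
    ((leftMinima σ).filter fun i => σ i ∈ below m k).card =
      ((leftMinima ⇑σ⁻¹).filter (· ∈ below m k)).card := by
  refine Finset.card_equiv σ fun i => ?_
  simp only [Finset.mem_filter]
  exact and_congr_left fun _ => ⟨apply_mem_leftMinima_inv, fun hi => by
    simpa using apply_mem_leftMinima_inv hi⟩

/-- The probability generating function of the number of left-to-right minima of a uniformly
random arrangement of `m` elements. -/
noncomputable def recordPgf (m : ℕ) (x : ℂ) : ℂ :=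
  ∏ j ∈ Finset.range m, (x + j) / (j + 1)

lemma factorial_mul_recordPgf (m : ℕ) (x : ℂ) :
    (m.factorial : ℂ) * recordPgf m x = ∏ j ∈ Finset.range m, (x + j) := by
  rw [recordPgf, Finset.prod_div_distrib, ← Finset.prod_range_add_one_eq_factorial]
  push_cast
  exact mul_div_cancel₀ _ (Finset.prod_ne_zero_iff.2 fun i _ => Nat.cast_add_one_ne_zero i)

lemma norm_add_natCast_div_le_one {x : ℂ} (hx : ‖x‖ = 1) (j : ℕ) :
    ‖(x + j) / ((j : ℂ) + 1)‖ ≤ 1 := by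
  rw [norm_div, ← Nat.cast_add_one, Complex.norm_natCast, div_le_one (by positivity)]
  calc ‖x + j‖ ≤ ‖x‖ + ‖(j : ℂ)‖ := norm_add_le _ _
    _ = (j + 1 : ℕ) := by rw [hx, Complex.norm_natCast]; push_cast; ring

lemma norm_recordPgf_le_one (m : ℕ) {x : ℂ} (hx : ‖x‖ = 1) : ‖recordPgf m x‖ ≤ 1 := by
  rw [recordPgf, norm_prod]
  exact Finset.prod_le_one (fun _ _ => norm_nonneg _) fun j _ => norm_add_natCast_div_le_one hx j

end Records

section ConjugationInvariance

variable {V : Type*} [MeasurableSpace (Equiv.Perm V)] {μ : Measure (Equiv.Perm V)}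
  [SMulInvariantMeasure (ConjAct (Equiv.Perm V)) (Equiv.Perm V) μ]

lemma measureReal_conj_singleton (π σ : Equiv.Perm V) : μ.real {π * σ * π⁻¹} = μ.real {σ} := by
  rw [← ConjAct.toConjAct_smul, ← Set.smul_set_singleton, measureReal_def, measure_smul,
    measureReal_def]

variable [DiscreteMeasurableSpace (Equiv.Perm V)] [IsFiniteMeasure μ]

lemma measureReal_le_of_mapsTo_conj {S T : Set (Equiv.Perm V)} (π : Equiv.Perm V)
    (h : Set.MapsTo (fun σ => π * σ * π⁻¹) S T) : μ.real S ≤ μ.real T :=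
  calc μ.real S ≤ μ.real ((ConjAct.toConjAct π • ·) ⁻¹' T) := measureReal_mono h
    _ = μ.real T := congrArg ENNReal.toReal
      (measure_preimage_smul_of_nullMeasurableSet
        (MeasurableSet.of_discrete (s := T)).nullMeasurableSet _)

lemma setIntegral_comp_conj [Finite V] {E : Type*} [NormedAddCommGroup E] [NormedSpace ℝ E]
    [CompleteSpace E] {S : Set (Equiv.Perm V)} (π : Equiv.Perm V → Equiv.Perm V)
    (hmaps : Set.MapsTo (fun σ => π σ * σ * (π σ)⁻¹) S S)
    (hinj : Set.InjOn (fun σ => π σ * σ * (π σ)⁻¹) S) (F : Equiv.Perm V → E) :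
    ∫ σ in S, F (π σ * σ * (π σ)⁻¹) ∂μ = ∫ σ in S, F σ ∂μ := by
  obtain ⟨S, rfl⟩ := S.toFinite.exists_finset_coe
  rw [setIntegral_finset _ Integrable.of_finite, setIntegral_finset _ Integrable.of_finite]
  refine Finset.sum_nbij (fun σ => π σ * σ * (π σ)⁻¹) hmaps hinj
    (Finset.surjOn_of_injOn_of_card_le _ hmaps hinj le_rfl) fun σ _ => ?_
  rw [measureReal_conj_singleton]

end ConjugationInvariance

section Placements

variable {V ι : Type*}

/-- Stability of a class `S` of permutations of `V` under the relabellings of `V` that fix `A`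
pointwise. -/
def IsConjStable (A : Set V) (S : Set (Equiv.Perm V)) : Prop :=
  ∀ π : Equiv.Perm V, (∀ a ∈ A, π a = a) → ∀ σ ∈ S, π * σ * π⁻¹ ∈ S

/-- The permutations of `V` that move every point of `A` out of `A`. -/
def displacing (A : Set V) : Set (Equiv.Perm V) :=
  {σ | ∀ a ∈ A, σ a ∉ A}

/-- A placement `g` of finitely many labels `ι` in `V`, read off from the permutations of a
class `S`, that avoids `A` and commutes with the relabellings of `V` fixing `A` pointwise. Under
a conjugation invariant law the order of the placed labels is then uniform. -/
structure IsEquivariantPlacement (A : Set V) (S : Set (Equiv.Perm V))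
    (g : Equiv.Perm V → ι → V) : Prop where
  conj_mem : IsConjStable A S
  map_conj : ∀ π : Equiv.Perm V, (∀ a ∈ A, π a = a) → ∀ σ ∈ S, g (π * σ * π⁻¹) = π ∘ g σ
  injective : ∀ σ ∈ S, (g σ).Injective
  notMem : ∀ σ ∈ S, ∀ k, g σ k ∉ A

lemma exists_perm_comp_eq_comp_perm [Finite ι] {A : Set V} {f : ι → V} (hf : f.Injective)
    (hfA : ∀ k, f k ∉ A) (ρ : Equiv.Perm ι) :
    ∃ π : Equiv.Perm V, (∀ a ∈ A, π a = a) ∧ π ∘ f = f ∘ ρ := by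
  classical
  have := Fintype.ofFinite ι
  refine ⟨ρ.viaFintypeEmbedding ⟨f, hf⟩, fun a ha => ?_, funext fun k => ?_⟩
  · refine Equiv.Perm.viaFintypeEmbedding_apply_notMem_range _ _ ?_
    rintro ⟨k, rfl⟩
    exact hfA k ha
  · exact Equiv.Perm.viaFintypeEmbedding_apply_image ρ ⟨f, hf⟩ k

lemma apply_notMem_of_fixes {A : Set V} {π : Equiv.Perm V} (hπ : ∀ a ∈ A, π a = a) {v : V}
    (hv : v ∉ A) : π v ∉ A :=
  fun h => hv (π.injective (hπ _ h) ▸ h)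

lemma conj_apply_eq_of_fixes {A : Set V} {π : Equiv.Perm V} (hπ : ∀ a ∈ A, π a = a)
    (σ : Equiv.Perm V) {a : V} (ha : a ∈ A) : (π * σ * π⁻¹) a = π (σ a) := by
  rw [Equiv.Perm.mul_apply, Equiv.Perm.mul_apply, Equiv.Perm.inv_eq_iff_eq.2 (hπ a ha).symm]

lemma isConjStable_displacing (A : Set V) : IsConjStable A (displacing A) := by
  intro π hπ σ hσ a ha
  rw [conj_apply_eq_of_fixes hπ σ ha]
  exact apply_notMem_of_fixes hπ (hσ a ha)

lemma IsConjStable.setOf_pow_mem {A : Set V} {S : Set (Equiv.Perm V)} (hS : IsConjStable A S)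
    (k : ℕ) : IsConjStable A {σ | σ ^ k ∈ S} := fun π hπ σ hσ => by
  rw [Set.mem_ofPred_eq, conj_pow]
  exact hS π hπ _ hσ

lemma IsConjStable.inter {A : Set V} {S T : Set (Equiv.Perm V)} (hS : IsConjStable A S)
    (hT : IsConjStable A T) : IsConjStable A (S ∩ T) :=
  fun π hπ σ hσ => ⟨hS π hπ σ hσ.1, hT π hπ σ hσ.2⟩

namespace IsEquivariantPlacement

lemma values {A : Set V} {S : Set (Equiv.Perm V)} (hS : IsConjStable A S)
    (hSA : S ⊆ displacing A) (e : ι ↪ V) (he : ∀ k, e k ∈ A) :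
    IsEquivariantPlacement A S fun σ => σ ∘ e where
  conj_mem := hS
  map_conj _ hπ σ _ := funext fun k => conj_apply_eq_of_fixes hπ σ (he k)
  injective σ _ := σ.injective.comp e.injective
  notMem _ hσ k := hSA hσ _ (he k)

lemma positions {A : Set V} {S : Set (Equiv.Perm V)} (hS : IsConjStable A S)
    (hSA : S ⊆ displacing A) (e : ι ↪ V) (he : ∀ k, e k ∈ A) :
    IsEquivariantPlacement A S fun σ => ⇑σ⁻¹ ∘ e where
  conj_mem := hS
  map_conj π hπ σ _ := funext fun k => by
    rw [conj_inv]
    exact conj_apply_eq_of_fixes hπ σ⁻¹ (he k)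
  injective σ _ := σ⁻¹.injective.comp e.injective
  notMem σ hσ k h := hSA hσ _ h (by simpa using he k)

lemma sumElim {ι' : Type*} {A : Set V} {S : Set (Equiv.Perm V)} {g : Equiv.Perm V → ι → V}
    {g' : Equiv.Perm V → ι' → V} (hg : IsEquivariantPlacement A S g)
    (hg' : IsEquivariantPlacement A S g') (hne : ∀ σ ∈ S, ∀ k l, g σ k ≠ g' σ l) :
    IsEquivariantPlacement A S fun σ => Sum.elim (g σ) (g' σ) where
  conj_mem := hg.conj_mem
  map_conj π hπ σ hσ := by
    rw [hg.map_conj π hπ σ hσ, hg'.map_conj π hπ σ hσ, Sum.comp_elim]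
  injective σ hσ := (hg.injective σ hσ).sumElim (hg'.injective σ hσ) (hne σ hσ)
  notMem σ hσ k := k.casesOn (hg.notMem σ hσ) (hg'.notMem σ hσ)

variable [Finite V] [MeasurableSpace (Equiv.Perm V)] [DiscreteMeasurableSpace (Equiv.Perm V)]
  {μ : Measure (Equiv.Perm V)} [IsFiniteMeasure μ]
  [SMulInvariantMeasure (ConjAct (Equiv.Perm V)) (Equiv.Perm V) μ]
  {A : Set V} {S : Set (Equiv.Perm V)} {g : Equiv.Perm V → ι → V}
  {E : Type*} [NormedAddCommGroup E] [NormedSpace ℝ E] [CompleteSpace E]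

-- Conjugating `σ` by a permutation depending only on `g σ` loses nothing, since that permutation
-- can be recovered from the image.
lemma setIntegral_comp_perm [Finite ι] (hg : IsEquivariantPlacement A S g) (ρ : Equiv.Perm ι)
    (F : (ι → V) → E) : ∫ σ in S, F (g σ ∘ ρ) ∂μ = ∫ σ in S, F (g σ) ∂μ := by
  have exists_shuffle (f : ι → V) : ∃ π : Equiv.Perm V, (∀ a ∈ A, π a = a) ∧
      (f.Injective → (∀ k, f k ∉ A) → π ∘ f = f ∘ ρ) := by
    by_cases hf : f.Injective ∧ ∀ k, f k ∉ A
    · obtain ⟨π, hπA, hπ⟩ := exists_perm_comp_eq_comp_perm hf.1 hf.2 ρ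
      exact ⟨π, hπA, fun _ _ => hπ⟩
    · exact ⟨1, fun _ _ => rfl, fun h h' => absurd ⟨h, h'⟩ hf⟩
  choose shuffle shuffle_fix shuffle_comp using exists_shuffle
  have placement_conj : ∀ σ ∈ S, g (shuffle (g σ) * σ * (shuffle (g σ))⁻¹) = g σ ∘ ρ :=
    fun σ hσ => (hg.map_conj _ (shuffle_fix _) σ hσ).trans
      (shuffle_comp _ (hg.injective σ hσ) (hg.notMem σ hσ))
  rw [← setIntegral_comp_conj (fun σ => shuffle (g σ))
    (fun σ hσ => hg.conj_mem _ (shuffle_fix _) σ hσ) _ fun σ => F (g σ)]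
  · exact setIntegral_congr_fun .of_discrete fun σ hσ => by rw [placement_conj σ hσ]
  · intro σ hσ σ' hσ' h
    have placement_eq : g σ = g σ' := by
      refine ρ.surjective.injective_comp_right ?_
      exact (placement_conj σ hσ).symm.trans ((congrArg g h).trans (placement_conj σ' hσ'))
    simpa [placement_eq] using h

lemma card_smul_setIntegral [Finite ι] {κ : Type*} [Fintype κ]
    (hg : IsEquivariantPlacement A S g) (r : κ → Equiv.Perm ι) (F : (ι → V) → E) (c : E)
    (hF : ∀ f : ι → V, f.Injective → ∑ k, F (f ∘ r k) = c) :
    Fintype.card κ • ∫ σ in S, F (g σ) ∂μ = μ.real S • c :=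
  calc Fintype.card κ • ∫ σ in S, F (g σ) ∂μ = ∑ k, ∫ σ in S, F (g σ ∘ r k) ∂μ := by
        simp_rw [hg.setIntegral_comp_perm, Finset.sum_const, Finset.card_univ]
    _ = ∫ σ in S, ∑ k, F (g σ ∘ r k) ∂μ :=
        (integral_finsetSum _ fun _ _ => Integrable.of_finite).symm
    _ = ∫ _ in S, c ∂μ :=
        setIntegral_congr_fun .of_discrete fun σ hσ => hF _ (hg.injective σ hσ)
    _ = μ.real S • c := setIntegral_const c

lemma measureReal_forall_notMem_le (hg : IsEquivariantPlacement A S g)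
    {Z : Finset V} (hZ : ∀ z ∈ Z, z ∉ A) {z : V} (hz : z ∈ Z) (k : ι) :
    μ.real {σ ∈ S | ∀ j, g σ j ∉ Z} ≤
      Nat.card V * μ.real {σ ∈ S | g σ k = z ∧ ∀ j ≠ k, g σ j ∉ Z} := by
  classical
  have := Fintype.ofFinite V
  have measure_fiber_le (y : V) : μ.real {σ ∈ S | (∀ j, g σ j ∉ Z) ∧ g σ k = y} ≤
      μ.real {σ ∈ S | g σ k = z ∧ ∀ j ≠ k, g σ j ∉ Z} := by
    by_cases hy : y ∈ A
    · have : {σ ∈ S | (∀ j, g σ j ∉ Z) ∧ g σ k = y} = ∅ :=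
        Set.eq_empty_of_forall_notMem fun σ ⟨hσ, _, h⟩ => hg.notMem σ hσ k (h ▸ hy)
      rw [this, measureReal_empty]
      exact measureReal_nonneg
    have swap_fix : ∀ a ∈ A, Equiv.swap y z a = a := fun a ha =>
      Equiv.swap_apply_of_ne_of_ne (fun h => hy (h ▸ ha)) fun h => hZ z hz (h ▸ ha)
    refine measureReal_le_of_mapsTo_conj (Equiv.swap y z) ?_
    rintro σ ⟨hσ, hσZ, rfl⟩
    refine ⟨hg.conj_mem _ swap_fix σ hσ, ?_⟩
    simp only [hg.map_conj _ swap_fix σ hσ, Function.comp_apply, Equiv.swap_apply_left, true_and]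
    intro j hj
    rw [Equiv.swap_apply_of_ne_of_ne ((hg.injective σ hσ).ne hj) fun h => hσZ j (h ▸ hz)]
    exact hσZ j
  calc μ.real {σ ∈ S | ∀ j, g σ j ∉ Z}
      ≤ μ.real (⋃ y, {σ ∈ S | (∀ j, g σ j ∉ Z) ∧ g σ k = y}) :=
        measureReal_mono fun σ ⟨hσ, hσZ⟩ => Set.mem_iUnion.2 ⟨_, hσ, hσZ, rfl⟩
    _ ≤ ∑ y, μ.real {σ ∈ S | (∀ j, g σ j ∉ Z) ∧ g σ k = y} := measureReal_iUnion_fintype_le _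
    _ ≤ ∑ _y : V, μ.real {σ ∈ S | g σ k = z ∧ ∀ j ≠ k, g σ j ∉ Z} :=
        Finset.sum_le_sum fun y _ => measure_fiber_le y
    _ = Nat.card V * μ.real {σ ∈ S | g σ k = z ∧ ∀ j ≠ k, g σ j ∉ Z} := by simp

lemma card_mul_measureReal_forall_notMem_le [Fintype ι] (hg : IsEquivariantPlacement A S g)
    {Z : Finset V} (hZ : ∀ z ∈ Z, z ∉ A) :
    Fintype.card ι * Z.card * μ.real {σ ∈ S | ∀ j, g σ j ∉ Z} ≤ Nat.card V * μ.real S := by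
  classical
  set onlyHit : ι × V → Set (Equiv.Perm V) :=
    fun p => {σ ∈ S | g σ p.1 = p.2 ∧ ∀ j ≠ p.1, g σ j ∉ Z}
  have onlyHit_disjoint :
      ((Finset.univ ×ˢ Z : Finset (ι × V)) : Set (ι × V)).PairwiseDisjoint onlyHit := by
    rintro ⟨k, z⟩ hz ⟨k', z'⟩ - hne
    refine Set.disjoint_left.2 fun σ ⟨_, hkz, _⟩ ⟨_, hkz', hk'⟩ => hne ?_
    simp only at hkz hkz' hk'
    have hkk' : k = k' := by
      by_contra h
      exact hk' k h (hkz ▸ (Finset.mem_product.1 hz).2)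
    exact Prod.ext hkk' (by rw [← hkz, ← hkz', hkk'])
  calc Fintype.card ι * Z.card * μ.real {σ ∈ S | ∀ j, g σ j ∉ Z}
      = ∑ _p ∈ (Finset.univ ×ˢ Z : Finset (ι × V)), μ.real {σ ∈ S | ∀ j, g σ j ∉ Z} := by
        simp
    _ ≤ ∑ p ∈ Finset.univ ×ˢ Z, Nat.card V * μ.real (onlyHit p) :=
        Finset.sum_le_sum fun p hp =>
          hg.measureReal_forall_notMem_le hZ (Finset.mem_product.1 hp).2 p.1
    _ = Nat.card V * μ.real (⋃ p ∈ Finset.univ ×ˢ Z, onlyHit p) := by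
        rw [measureReal_biUnion_finset onlyHit_disjoint fun _ _ => .of_discrete,
          Finset.mul_sum]
    _ ≤ Nat.card V * μ.real S :=
        mul_le_mul_of_nonneg_left
          (measureReal_mono (Set.iUnion₂_subset fun _ _ _ hσ => hσ.1)) (Nat.cast_nonneg _)

lemma setIntegral_pow_card_leftMinima [LinearOrder V] {m : ℕ} {g : Equiv.Perm V → Fin m → V}
    (hg : IsEquivariantPlacement A S g) (x : ℂ) :
    ∫ σ in S, x ^ (leftMinima (g σ)).card ∂μ = μ.real S * recordPgf m x := by
  have average := hg.card_smul_setIntegral (μ := μ) (κ := Equiv.Perm (Fin m)) id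
    (fun f => x ^ (leftMinima f).card) _ fun f hf => sum_pow_card_leftMinima_comp f hf x
  rw [← factorial_mul_recordPgf, Fintype.card_perm, Fintype.card_fin, nsmul_eq_mul,
    Complex.real_smul, mul_left_comm] at average
  exact mul_left_cancel₀ (Nat.cast_ne_zero.2 m.factorial_ne_zero) average

lemma setIntegral_pow_card_leftMinima_sumElim [LinearOrder V] {m m' : ℕ}
    {g : Equiv.Perm V → Fin m → V} {g' : Equiv.Perm V → Fin m' → V}
    (hg : IsEquivariantPlacement A S fun σ => Sum.elim (g σ) (g' σ)) (x : ℂ) :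
    ∫ σ in S, x ^ ((leftMinima (g σ)).card + (leftMinima (g' σ)).card) ∂μ =
      μ.real S * (recordPgf m x * recordPgf m' x) := by
  have average := hg.card_smul_setIntegral (μ := μ)
    (κ := Equiv.Perm (Fin m) × Equiv.Perm (Fin m')) (fun ρ => Equiv.sumCongr ρ.1 ρ.2)
    (fun f => x ^ ((leftMinima (f ∘ Sum.inl)).card + (leftMinima (f ∘ Sum.inr)).card))
    ((∏ j ∈ Finset.range m, (x + j)) * ∏ j ∈ Finset.range m', (x + j)) fun f hf => by
      rw [← sum_pow_card_leftMinima_comp _ (hf.comp Sum.inl_injective),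
        ← sum_pow_card_leftMinima_comp _ (hf.comp Sum.inr_injective), Finset.sum_mul_sum,
        ← Fintype.sum_prod_type']
      exact Finset.sum_congr rfl fun ρ _ => pow_add _ _ _
  simp only [Sum.elim_comp_inl, Sum.elim_comp_inr, ← factorial_mul_recordPgf, Fintype.card_prod,
    Fintype.card_perm, Fintype.card_fin, nsmul_eq_mul, Complex.real_smul] at average
  refine mul_left_cancel₀ (Nat.cast_ne_zero.2
    (mul_ne_zero m.factorial_ne_zero m'.factorial_ne_zero)) (average.trans ?_)
  push_cast
  ring

end IsEquivariantPlacement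

end Placements

section StayCount

variable {V : Type*}

/-- The number of points of `W` that the permutation `σ` sends into `W`. -/
def stayCount [DecidableEq V] (W : Finset V) (σ : Equiv.Perm V) : ℕ :=
  (W.filter fun i => σ i ∈ W).card

lemma stayCount_eq_zero_iff [DecidableEq V] {W : Finset V} {σ : Equiv.Perm V} :
    stayCount W σ = 0 ↔ σ ∈ displacing (W : Set V) := by
  rw [stayCount, Finset.card_eq_zero, Finset.filter_eq_empty_iff]
  rfl

variable [MeasurableSpace (Equiv.Perm V)] [DiscreteMeasurableSpace (Equiv.Perm V)]
  {μ : Measure (Equiv.Perm V)}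

lemma sub_one_mul_measureReal_apply_eq_le [Fintype V] [IsProbabilityMeasure μ]
    [SMulInvariantMeasure (ConjAct (Equiv.Perm V)) (Equiv.Perm V) μ] {i j : V} (hij : j ≠ i) :
    (Fintype.card V - 1) * μ.real {σ | σ i = j} ≤ 1 := by
  classical
  have apply_eq_le : ∀ j' ∈ Finset.univ.erase i, μ.real {σ | σ i = j} ≤ μ.real {σ | σ i = j'} := by
    intro j' hj'
    refine measureReal_le_of_mapsTo_conj (Equiv.swap j j') fun σ hσ => ?_
    have swap_fix : (Equiv.swap j j')⁻¹ i = i := by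
      rw [Equiv.swap_inv, Equiv.swap_apply_of_ne_of_ne hij.symm (Finset.ne_of_mem_erase hj').symm]
    rw [Set.mem_ofPred_eq, Equiv.Perm.mul_apply, Equiv.Perm.mul_apply, swap_fix, hσ.out,
      Equiv.swap_apply_left]
  calc (Fintype.card V - 1) * μ.real {σ | σ i = j}
      = ∑ _j' ∈ Finset.univ.erase i, μ.real {σ | σ i = j} := by
        rw [Finset.sum_const, Finset.card_erase_of_mem (Finset.mem_univ i), Finset.card_univ,
          nsmul_eq_mul, Nat.cast_pred (Fintype.card_pos_iff.2 ⟨i⟩)]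
    _ ≤ ∑ j' ∈ Finset.univ.erase i, μ.real ((fun σ => σ i) ⁻¹' {j'}) :=
        Finset.sum_le_sum apply_eq_le
    _ ≤ 1 := by
        rw [sum_measureReal_preimage_singleton _ fun _ _ => .of_discrete]
        exact measureReal_le_one

variable [DecidableEq V]

lemma integral_stayCount [Finite V] [IsFiniteMeasure μ] (W : Finset V) :
    ∫ σ, (stayCount W σ : ℝ) ∂μ = ∑ i ∈ W, ∑ j ∈ W, μ.real {σ | σ i = j} := by
  have stayCount_eq (σ : Equiv.Perm V) : (stayCount W σ : ℝ) =
      ∑ i ∈ W, ∑ j ∈ W, {σ : Equiv.Perm V | σ i = j}.indicator (1 : Equiv.Perm V → ℝ) σ := by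
    simp [stayCount, Set.indicator_apply]
  simp_rw [stayCount_eq]
  rw [integral_finsetSum _ fun _ _ => Integrable.of_finite]
  refine Finset.sum_congr rfl fun i _ => ?_
  rw [integral_finsetSum _ fun _ _ => Integrable.of_finite]
  exact Finset.sum_congr rfl fun j _ => integral_indicator_one .of_discrete

lemma measureReal_compl_displacing_le [Finite V] [IsFiniteMeasure μ] (W : Finset V) :
    μ.real (displacing (W : Set V))ᶜ ≤ ∫ σ, (stayCount W σ : ℝ) ∂μ := by
  have markov := mul_meas_ge_le_integral_of_nonneg (μ := μ) (f := fun σ => (stayCount W σ : ℝ))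
    (.of_forall fun _ => Nat.cast_nonneg _) Integrable.of_finite 1
  rw [one_mul] at markov
  refine le_trans (measureReal_mono fun σ hσ => ?_) markov
  rw [Set.mem_compl_iff, ← stayCount_eq_zero_iff] at hσ
  exact (Nat.one_le_cast (α := ℝ)).2 (Nat.one_le_iff_ne_zero.2 hσ)

variable [Fintype V] [SMulInvariantMeasure (ConjAct (Equiv.Perm V)) (Equiv.Perm V) μ]

lemma card_mul_measureReal_apply_eq_self [IsFiniteMeasure μ] (i : V) :
    Fintype.card V * μ.real {σ | σ i = i} =
      ∫ σ, (Fintype.card (Function.fixedPoints σ) : ℝ) ∂μ := by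
  have fixes_le (i j : V) : μ.real {σ | σ i = i} ≤ μ.real {σ | σ j = j} :=
    measureReal_le_of_mapsTo_conj (Equiv.swap i j) fun σ hσ => by
      rw [Set.mem_ofPred_eq, Equiv.Perm.mul_apply, Equiv.Perm.mul_apply, Equiv.swap_inv,
        Equiv.swap_apply_right, hσ.out, Equiv.swap_apply_left]
  have card_eq (σ : Equiv.Perm V) : (Fintype.card (Function.fixedPoints σ) : ℝ) =
      ∑ j, {σ : Equiv.Perm V | σ j = j}.indicator (1 : Equiv.Perm V → ℝ) σ := by
    rw [Fintype.card_of_subtype (Finset.univ.filter fun j => σ j = j) (by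
      simp [Function.IsFixedPt])]
    simp [Set.indicator_apply]
  simp_rw [card_eq]
  rw [integral_finsetSum _ fun _ _ => Integrable.of_finite]
  rw [Finset.sum_congr rfl fun j _ => (integral_indicator_one .of_discrete).trans
    ((fixes_le j i).antisymm (fixes_le i j)), Finset.sum_const, Finset.card_univ, nsmul_eq_mul]

lemma integral_stayCount_le [IsProbabilityMeasure μ] (hV : 1 < Fintype.card V) (W : Finset V) :
    ∫ σ, (stayCount W σ : ℝ) ∂μ ≤
      W.card * ((∫ σ, (Fintype.card (Function.fixedPoints σ) : ℝ) ∂μ) / Fintype.card V) +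
        (W.card : ℝ) ^ 2 / (Fintype.card V - 1) := by
  have card_sub_one_pos : (0 : ℝ) < Fintype.card V - 1 := sub_pos.2 (by exact_mod_cast hV)
  have row_le : ∀ i ∈ W, ∑ j ∈ W, μ.real {σ | σ i = j} ≤
      (∫ σ, (Fintype.card (Function.fixedPoints σ) : ℝ) ∂μ) / Fintype.card V +
        W.card * (1 / (Fintype.card V - 1)) := by
    intro i hi
    rw [← Finset.add_sum_erase _ _ hi, ← card_mul_measureReal_apply_eq_self i,
      mul_div_cancel_left₀ _ (by positivity)]
    gcongr
    calc ∑ j ∈ W.erase i, μ.real {σ | σ i = j}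
        ≤ (W.erase i).card • (1 / (Fintype.card V - 1) : ℝ) :=
          Finset.sum_le_card_nsmul _ _ _ fun j hj => by
            rw [le_div_iff₀' card_sub_one_pos]
            exact sub_one_mul_measureReal_apply_eq_le (Finset.ne_of_mem_erase hj)
      _ ≤ W.card * (1 / (Fintype.card V - 1)) := by
          rw [nsmul_eq_mul]
          gcongr
          exact W.erase_subset i
  rw [integral_stayCount]
  exact (Finset.sum_le_card_nsmul _ _ _ row_le).trans_eq (by rw [nsmul_eq_mul]; ring)

end StayCount

section LowRecords

variable {m : ℕ}

/-- Low records of a permutation and of its inverse correspond, so those at a small position and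
those with a small value are both counted by a restriction to the first `m` positions. -/
lemma lrec_eq_add_add {n : ℕ} (h : m ≤ n) {σ : Equiv.Perm (Fin n)}
    (hσ : σ ∈ displacing (below n m : Set (Fin n))) :
    lrec σ = (leftMinima (σ ∘ Fin.castLE h)).card + (leftMinima (⇑σ⁻¹ ∘ Fin.castLE h)).card +
      ((leftMinima σ).filter fun i => i ∉ below n m ∧ σ i ∉ below n m).card := by
  have value_filter : ((leftMinima σ).filter fun i => i ∉ below n m ∧ σ i ∈ below n m) =
      (leftMinima σ).filter fun i => σ i ∈ below n m :=
    Finset.filter_congr fun i _ => and_iff_right_of_imp fun hi hi' => hσ i hi' hi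
  rw [← card_filter_leftMinima_mem_below h σ, ← card_filter_leftMinima_mem_below h ⇑σ⁻¹,
    ← card_filter_leftMinima_apply_mem_below, ← value_filter, add_assoc,
    ← Finset.filter_filter, ← Finset.filter_filter, Finset.card_filter_add_card_filter_not,
    Finset.card_filter_add_card_filter_not]
  rfl

lemma card_filter_leftMinima_notMem_below_le {n L : ℕ} (h : m ≤ n) (σ : Equiv.Perm (Fin n))
    (hval : ∃ k, (σ ∘ Fin.castLE h) k ∈ below n L)
    (hpos : ∃ k, (⇑σ⁻¹ ∘ Fin.castLE h) k ∈ below n L) :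
    ((leftMinima σ).filter fun i => i ∉ below n m ∧ σ i ∉ below n m).card ≤
      stayCount (below n L) σ := by
  obtain ⟨k, hk⟩ := hval
  obtain ⟨l, hl⟩ := hpos
  refine Finset.card_le_card fun i hi => ?_
  simp only [leftMinima, mem_below, Finset.mem_filter, Finset.mem_univ, true_and, not_lt,
    Function.comp_apply] at hi hk hl ⊢
  obtain ⟨hi, hmi, hmσ⟩ := hi
  constructor
  · refine lt_of_le_of_lt (not_lt.1 fun hlt => ?_) hl
    have value_lt := hi (σ⁻¹ (Fin.castLE h l)) hlt
    rw [Equiv.Perm.coe_inv, Equiv.apply_symm_apply] at value_lt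
    exact (hmσ.trans_lt value_lt).not_ge l.2.le
  · exact lt_trans (hi (Fin.castLE h k) (Fin.lt_def.2 (k.2.trans_le hmi))) hk

end LowRecords

section Comparison

variable {n m L : ℕ}

lemma norm_pow_lrec_sub_le (h : m ≤ n) {σ : Equiv.Perm (Fin n)}
    (hσ : σ ∈ displacing (below n m : Set (Fin n))) {x : ℂ} (hx : ‖x‖ = 1)
    (hval : ∃ k, (σ ∘ Fin.castLE h) k ∈ below n L)
    (hpos : ∃ k, (⇑σ⁻¹ ∘ Fin.castLE h) k ∈ below n L) :
    ‖x ^ lrec σ - x ^ ((leftMinima (σ ∘ Fin.castLE h)).card +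
        (leftMinima (⇑σ⁻¹ ∘ Fin.castLE h)).card)‖ ≤ ‖x - 1‖ * stayCount (below n L) σ := by
  rw [lrec_eq_add_add h hσ, pow_add, ← mul_sub_one, norm_mul, norm_pow, hx, one_pow, one_mul]
  refine (norm_pow_sub_one_le hx.le _).trans ?_
  rw [mul_comm]
  gcongr
  exact card_filter_leftMinima_notMem_below_le h σ hval hpos

lemma norm_pow_lrec_sub_le_indicator_add (h : m ≤ n) {M : Set (Equiv.Perm (Fin n))}
    {σ : Equiv.Perm (Fin n)} (hσ : σ ∈ displacing (below n m : Set (Fin n))) {x : ℂ}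
    (hx : ‖x‖ = 1)
    (hM : σ ∉ M → (∃ k, (σ ∘ Fin.castLE h) k ∈ below n L) ∧
      ∃ k, (⇑σ⁻¹ ∘ Fin.castLE h) k ∈ below n L) :
    ‖x ^ lrec σ - x ^ ((leftMinima (σ ∘ Fin.castLE h)).card +
        (leftMinima (⇑σ⁻¹ ∘ Fin.castLE h)).card)‖ ≤
      2 * M.indicator (fun _ => (1 : ℝ)) σ + ‖x - 1‖ * stayCount (below n L) σ := by
  by_cases hmem : σ ∈ M
  · rw [Set.indicator_of_mem hmem]
    refine (norm_sub_le _ _).trans ?_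
    rw [norm_pow, norm_pow, hx, one_pow, one_pow, one_add_one_eq_two, mul_one]
    exact le_add_of_nonneg_right (by positivity)
  · rw [Set.indicator_of_notMem hmem, mul_zero, zero_add]
    exact norm_pow_lrec_sub_le h hσ hx (hM hmem).1 (hM hmem).2

variable {μ : Measure (Equiv.Perm (Fin n))} [IsProbabilityMeasure μ]
  [SMulInvariantMeasure (ConjAct (Equiv.Perm (Fin n))) (Equiv.Perm (Fin n)) μ]
  {S : Set (Equiv.Perm (Fin n))}

lemma IsEquivariantPlacement.measureReal_forall_notMem_below_le
    {g : Equiv.Perm (Fin n) → Fin m → Fin n}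
    (hg : IsEquivariantPlacement (below n m : Set (Fin n)) S g) (hm : 0 < m) (hmL : m < L)
    (hL : L ≤ n) :
    μ.real {σ ∈ S | ∀ k, g σ k ∉ below n L} ≤ n / (m * (L - m)) := by
  have subset : below n m ⊆ below n L := fun i hi =>
    mem_below.2 ((mem_below.1 hi).trans hmL)
  have avoid := hg.card_mul_measureReal_forall_notMem_le (μ := μ) (Z := below n L \ below n m)
    fun z hz => (Finset.mem_sdiff.1 hz).2
  rw [Finset.cast_card_sdiff subset, card_below hL, card_below (hmL.le.trans hL),
    Fintype.card_fin, Nat.card_fin] at avoid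
  rw [le_div_iff₀' (mul_pos (Nat.cast_pos.2 hm) (sub_pos.2 (Nat.cast_lt.2 hmL)))]
  calc (m * (L - m) : ℝ) * μ.real {σ ∈ S | ∀ k, g σ k ∉ below n L}
      ≤ m * (L - m) * μ.real {σ ∈ S | ∀ k, g σ k ∉ below n L \ below n m} := by
        refine mul_le_mul_of_nonneg_left (measureReal_mono fun σ hσ =>
          ⟨hσ.1, fun k hk => hσ.2 k (Finset.mem_sdiff.1 hk).1⟩) ?_
        exact mul_nonneg (Nat.cast_nonneg _) (sub_nonneg.2 (Nat.cast_le.2 hmL.le))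
    _ ≤ n * μ.real S := avoid
    _ ≤ n := mul_le_of_le_one_right (Nat.cast_nonneg _) measureReal_le_one

lemma norm_setIntegral_pow_lrec_sub_le (h : m ≤ n)
    (hS : IsConjStable (below n m : Set (Fin n)) S)
    (hSm : S ⊆ displacing (below n m : Set (Fin n))) (hm : 0 < m) (hmL : m < L) (hL : L ≤ n)
    {x : ℂ} (hx : ‖x‖ = 1) :
    ‖∫ σ in S, x ^ lrec σ ∂μ - ∫ σ in S, x ^ ((leftMinima (σ ∘ Fin.castLE h)).card +
        (leftMinima (⇑σ⁻¹ ∘ Fin.castLE h)).card) ∂μ‖ ≤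
      4 * (n / (m * (L - m))) + ‖x - 1‖ * ∫ σ, (stayCount (below n L) σ : ℝ) ∂μ := by
  have castLE_mem (k : Fin m) : Fin.castLEEmb h k ∈ below n m := mem_below.2 k.2
  have miss_values : μ.real {σ ∈ S | ∀ k, (σ ∘ Fin.castLE h) k ∉ below n L} ≤ n / (m * (L - m)) :=
    (IsEquivariantPlacement.values hS hSm (Fin.castLEEmb h)
      castLE_mem).measureReal_forall_notMem_below_le hm hmL hL
  have miss_positions :
      μ.real {σ ∈ S | ∀ k, (⇑σ⁻¹ ∘ Fin.castLE h) k ∉ below n L} ≤ n / (m * (L - m)) :=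
    (IsEquivariantPlacement.positions hS hSm (Fin.castLEEmb h)
      castLE_mem).measureReal_forall_notMem_below_le hm hmL hL
  set missed : Set (Equiv.Perm (Fin n)) :=
    {σ ∈ S | ∀ k, (σ ∘ Fin.castLE h) k ∉ below n L} ∪
      {σ ∈ S | ∀ k, (⇑σ⁻¹ ∘ Fin.castLE h) k ∉ below n L} with missed_def
  have mem_of_notMem_missed : ∀ σ ∈ S, σ ∉ missed →
      (∃ k, (σ ∘ Fin.castLE h) k ∈ below n L) ∧ ∃ k, (⇑σ⁻¹ ∘ Fin.castLE h) k ∈ below n L :=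
    fun σ hσ hmem => by
      simpa only [missed_def, Set.mem_union, Set.mem_ofPred_eq, hσ, true_and, not_or, not_forall,
        not_not] using hmem
  rw [← integral_sub .of_finite .of_finite]
  calc _ ≤ ∫ σ in S, ‖x ^ lrec σ - x ^ ((leftMinima (σ ∘ Fin.castLE h)).card +
          (leftMinima (⇑σ⁻¹ ∘ Fin.castLE h)).card)‖ ∂μ := norm_integral_le_integral_norm _
    _ ≤ ∫ σ in S, (2 * missed.indicator (fun _ => (1 : ℝ)) σ +
          ‖x - 1‖ * stayCount (below n L) σ) ∂μ :=
        setIntegral_mono_on Integrable.of_finite Integrable.of_finite .of_discrete fun σ hσ =>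
          norm_pow_lrec_sub_le_indicator_add h (hSm hσ) hx (mem_of_notMem_missed σ hσ)
    _ ≤ ∫ σ, (2 * missed.indicator (fun _ => (1 : ℝ)) σ +
          ‖x - 1‖ * stayCount (below n L) σ) ∂μ :=
        setIntegral_le_integral .of_finite (.of_forall fun σ => add_nonneg
          (mul_nonneg zero_le_two (Set.indicator_nonneg (fun _ _ => zero_le_one) σ))
          (by positivity))
    _ = 2 * μ.real missed + ‖x - 1‖ * ∫ σ, (stayCount (below n L) σ : ℝ) ∂μ := by
        rw [integral_add .of_finite .of_finite, integral_const_mul, integral_const_mul,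
          integral_indicator_const _ .of_discrete, smul_eq_mul, mul_one]
    _ ≤ _ := by
        linarith [(measureReal_union_le (μ := μ) _ _).trans (add_le_add miss_values miss_positions)]

lemma norm_integral_pow_lrec_sub_le (h : m ≤ n)
    (hS : IsConjStable (below n m : Set (Fin n)) S)
    (hSm : S ⊆ displacing (below n m : Set (Fin n))) (hm : 0 < m) (hmL : m < L) (hL : L ≤ n)
    {x Φ : ℂ} (hx : ‖x‖ = 1) (hΦ : ‖Φ‖ ≤ 1)
    (hSΦ : ∫ σ in S, x ^ ((leftMinima (σ ∘ Fin.castLE h)).card +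
      (leftMinima (⇑σ⁻¹ ∘ Fin.castLE h)).card) ∂μ = μ.real S * Φ) :
    ‖∫ σ, x ^ lrec σ ∂μ - Φ‖ ≤ 2 * μ.real Sᶜ + 4 * (n / (m * (L - m))) +
      ‖x - 1‖ * ∫ σ, (stayCount (below n L) σ : ℝ) ∂μ := by
  have on_S := norm_setIntegral_pow_lrec_sub_le (μ := μ) h hS hSm hm hmL hL hx
  have off_S : ‖∫ σ in Sᶜ, x ^ lrec σ ∂μ‖ ≤ μ.real Sᶜ := by
    simpa using norm_setIntegral_le_of_norm_le_const (μ := μ) (s := Sᶜ) (measure_lt_top _ _)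
      (C := 1) (f := fun σ => x ^ lrec σ) fun σ _ => by rw [norm_pow, hx, one_pow]
  have missing_mass : ‖(μ.real Sᶜ : ℂ) * Φ‖ ≤ μ.real Sᶜ := by
    rw [norm_mul, Complex.norm_real, Real.norm_of_nonneg measureReal_nonneg]
    exact mul_le_of_le_one_right measureReal_nonneg hΦ
  have split : ∫ σ, x ^ lrec σ ∂μ - Φ =
      (∫ σ in S, x ^ lrec σ ∂μ - μ.real S * Φ) + ∫ σ in Sᶜ, x ^ lrec σ ∂μ -
        (μ.real Sᶜ : ℂ) * Φ := by
    rw [← integral_add_compl (.of_discrete : MeasurableSet S) .of_finite,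
      probReal_compl_eq_one_sub .of_discrete]
    push_cast
    ring
  rw [hSΦ] at on_S
  rw [split]
  calc _ ≤ _ := norm_sub_le _ _
    _ ≤ _ := add_le_add_left (norm_add_le _ _) _
    _ ≤ _ := by linarith

end Comparison

section PartialRecords

variable {n m : ℕ} {μ : Measure (Equiv.Perm (Fin n))} [IsFiniteMeasure μ]
  [SMulInvariantMeasure (ConjAct (Equiv.Perm (Fin n))) (Equiv.Perm (Fin n)) μ]

lemma setIntegral_displacing_pow_of_sq_eq_one (h : m ≤ n) (hμ : ∀ᵐ σ ∂μ, σ ^ 2 = 1) (x : ℂ) :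
    ∫ σ in displacing (below n m : Set (Fin n)), x ^ ((leftMinima (σ ∘ Fin.castLE h)).card +
        (leftMinima (⇑σ⁻¹ ∘ Fin.castLE h)).card) ∂μ =
      μ.real (displacing (below n m : Set (Fin n))) * recordPgf m (x ^ 2) := by
  rw [← (IsEquivariantPlacement.values (isConjStable_displacing (below n m : Set (Fin n)))
    Set.Subset.rfl (Fin.castLEEmb h) fun k => mem_below.2 k.2).setIntegral_pow_card_leftMinima]
  refine integral_congr_ae (ae_restrict_of_ae (hμ.mono fun σ hσ => ?_))
  have inv_eq : σ⁻¹ = σ := inv_eq_of_mul_eq_one_left (by rw [← sq, hσ])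
  simp only [inv_eq, ← two_mul, pow_mul, Fin.coe_castLEEmb]

lemma setIntegral_displacing_inter_pow (h : m ≤ n) (x : ℂ) :
    ∫ σ in displacing (below n m : Set (Fin n)) ∩ {σ | σ ^ 2 ∈ displacing (below n m)},
        x ^ ((leftMinima (σ ∘ Fin.castLE h)).card + (leftMinima (⇑σ⁻¹ ∘ Fin.castLE h)).card) ∂μ =
      μ.real (displacing (below n m : Set (Fin n)) ∩ {σ | σ ^ 2 ∈ displacing (below n m)}) *
        recordPgf m x ^ 2 := by
  have stable := isConjStable_displacing (below n m : Set (Fin n))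
  have castLE_mem (k : Fin m) : Fin.castLEEmb h k ∈ (below n m : Set (Fin n)) := mem_below.2 k.2
  have values := IsEquivariantPlacement.values (stable.inter (stable.setOf_pow_mem 2))
    Set.inter_subset_left _ castLE_mem
  have positions := IsEquivariantPlacement.positions (stable.inter (stable.setOf_pow_mem 2))
    Set.inter_subset_left _ castLE_mem
  rw [sq]
  refine (values.sumElim positions fun σ hσ k l hkl =>
    hσ.2 _ (castLE_mem k) ?_).setIntegral_pow_card_leftMinima_sumElim x
  rw [sq, Equiv.Perm.mul_apply, show σ (Fin.castLEEmb h k) = _ from hkl, Function.comp_apply,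
    Equiv.Perm.coe_inv, Equiv.apply_symm_apply]
  exact castLE_mem l

end PartialRecords

section GeneratingFunctionLimit

open Topology

lemma exp_mul_harmonic (z : ℂ) (m : ℕ) :
    Complex.exp (z * (harmonic m : ℝ)) =
      ∏ j ∈ Finset.range m, Complex.exp (z / ((j : ℂ) + 1)) := by
  rw [← Complex.exp_sum, harmonic]
  push_cast
  rw [Finset.mul_sum]
  simp only [div_eq_mul_inv]

lemma norm_add_div_sub_exp_le {x : ℂ} (hx : ‖x - 1‖ ≤ 1) (j : ℕ) :
    ‖(x + j) / ((j : ℂ) + 1) - Complex.exp ((x - 1) / ((j : ℂ) + 1))‖ ≤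
      1 / ((j : ℝ) + 1) ^ 2 * ‖x - 1‖ ^ 2 := by
  have norm_eq : ‖(x - 1) / ((j : ℂ) + 1)‖ = ‖x - 1‖ / (j + 1) := by
    rw [norm_div, ← Nat.cast_add_one, Complex.norm_natCast, Nat.cast_add_one]
  have norm_le_one : ‖(x - 1) / ((j : ℂ) + 1)‖ ≤ 1 := by
    rw [norm_eq]
    exact div_le_one_of_le₀ (hx.trans (le_add_of_nonneg_left j.cast_nonneg)) (by positivity)
  have factor_eq : (x + j) / ((j : ℂ) + 1) = 1 + (x - 1) / (j + 1) := by
    have := Nat.cast_add_one_ne_zero (R := ℂ) j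
    field_simp
    ring
  calc _ = ‖Complex.exp ((x - 1) / ((j : ℂ) + 1)) - 1 - (x - 1) / (j + 1)‖ := by
        rw [factor_eq, norm_sub_rev, sub_sub]
    _ ≤ ‖(x - 1) / ((j : ℂ) + 1)‖ ^ 2 := Complex.norm_exp_sub_one_sub_id_le norm_le_one
    _ = 1 / ((j : ℝ) + 1) ^ 2 * ‖x - 1‖ ^ 2 := by rw [norm_eq, div_pow]; ring

lemma norm_recordPgf_sub_exp_le (m : ℕ) {x : ℂ} (hx : ‖x‖ = 1) (hx1 : ‖x - 1‖ ≤ 1) :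
    ‖recordPgf m x - Complex.exp ((x - 1) * (harmonic m : ℝ))‖ ≤
      (∑' j : ℕ, 1 / ((j : ℝ) + 1) ^ 2) * ‖x - 1‖ ^ 2 := by
  have summable : Summable fun j : ℕ => 1 / ((j : ℝ) + 1) ^ 2 := by
    simpa using (summable_nat_add_iff 1).2 (Real.summable_one_div_nat_pow.2 (le_refl 2))
  have norm_exp_le (j : ℕ) : ‖Complex.exp ((x - 1) / ((j : ℂ) + 1))‖ ≤ 1 := by
    rw [Complex.norm_exp, Real.exp_le_one_iff, ← Nat.cast_add_one, Complex.div_natCast_re]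
    refine div_nonpos_of_nonpos_of_nonneg ?_ (Nat.cast_nonneg _)
    simpa [hx] using Complex.re_le_norm x
  rw [exp_mul_harmonic, recordPgf]
  calc _ ≤ ∑ j ∈ Finset.range m,
          ‖(x + j) / ((j : ℂ) + 1) - Complex.exp ((x - 1) / ((j : ℂ) + 1))‖ :=
        norm_prod_sub_prod_le _ (fun j _ => norm_add_natCast_div_le_one hx j)
          fun j _ => norm_exp_le j
    _ ≤ (∑ j ∈ Finset.range m, 1 / ((j : ℝ) + 1) ^ 2) * ‖x - 1‖ ^ 2 := by
        rw [Finset.sum_mul]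
        exact Finset.sum_le_sum fun j _ => norm_add_div_sub_exp_le hx1 j
    _ ≤ (∑' j : ℕ, 1 / ((j : ℝ) + 1) ^ 2) * ‖x - 1‖ ^ 2 := by
        gcongr
        exact summable.sum_le_tsum _ fun _ _ => by positivity

variable {ι : Type*} {F : Filter ι} {l : ι → ℝ}

lemma tendsto_exp_sub_one_mul_sub (hl : Tendsto l F atTop) {h : ι → ℝ}
    (hh : (fun i => h i - l i ^ 2 / 2) =o[F] l) (a : ℝ) :
    Tendsto (fun i => (Complex.exp (Complex.I * (a / l i : ℝ)) - 1) * h i -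
      Complex.I * (a * l i / 2 : ℝ)) F (𝓝 (-((a ^ 2 / 4 : ℝ) : ℂ))) := by
  have drift : Tendsto (fun i => (h i - l i ^ 2 / 2) / l i) F (𝓝 0) := hh.tendsto_div_nhds_zero
  have inv_tendsto : Tendsto (fun i => (l i)⁻¹) F (𝓝 0) := hl.inv_tendsto_atTop
  have ratio : Tendsto (fun i => h i / l i ^ 2) F (𝓝 (1 / 2)) := by
    have := (drift.mul inv_tendsto).add_const (1 / 2 : ℝ)
    rw [zero_mul, zero_add] at this
    refine this.congr' ((hl.eventually_gt_atTop 0).mono fun i hi => ?_)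
    field_simp
    ring
  have exponent_tendsto : Tendsto (fun i => Complex.I * (a / l i : ℝ)) F (𝓝 0) := by
    have := (Complex.continuous_ofReal.tendsto _).comp (inv_tendsto.const_mul a)
    simpa [div_eq_mul_inv] using this.const_mul Complex.I
  have remainder : (fun i => Complex.exp (Complex.I * (a / l i : ℝ)) - 1 -
      Complex.I * (a / l i : ℝ) + ((a / l i) ^ 2 / 2 : ℝ)) =o[F] fun i => ((l i : ℂ)⁻¹) ^ 2 := by
    refine (((Complex.exp_sub_sum_range_succ_isLittleO_pow 2).comp_tendsto
      exponent_tendsto).congr (fun i => ?_) fun i => ?_).trans_isBigO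
      (isBigO_const_mul_self (-(a : ℂ) ^ 2) _ _)
    · simp only [Function.comp, Finset.sum_range_succ, Finset.sum_range_zero, mul_pow,
        Complex.I_sq, Nat.factorial]
      push_cast
      ring
    · simp only [Function.comp, mul_pow, Complex.I_sq]
      push_cast
      ring
  have ratio_complex := (Complex.continuous_ofReal.tendsto _).comp ratio
  have limit := ((remainder.tendsto_div_nhds_zero.mul ratio_complex).add
    (((Complex.continuous_ofReal.tendsto _).comp drift).const_mul (Complex.I * a))).sub
      (ratio_complex.const_mul ((a : ℂ) ^ 2 / 2))
  convert limit.congr' ((hl.eventually_ne_atTop 0).mono fun i hi => ?_) using 2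
  · push_cast
    ring
  · have hi' : (l i : ℂ) ≠ 0 := Complex.ofReal_ne_zero.2 hi
    simp only [Function.comp]
    push_cast
    field_simp
    ring

lemma tendsto_recordPgf_mul_exp (hl : Tendsto l F atTop) {m : ι → ℕ}
    (hm : (fun i => (harmonic (m i) : ℝ) - l i ^ 2 / 2) =o[F] l) (a : ℝ) :
    Tendsto (fun i => recordPgf (m i) (Complex.exp (Complex.I * (a / l i : ℝ))) *
      Complex.exp (-(Complex.I * (a * l i / 2 : ℝ)))) F
      (𝓝 (Complex.exp (-((a ^ 2 / 4 : ℝ) : ℂ)))) := by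
  have step_tendsto : Tendsto (fun i => ‖a / l i‖) F (𝓝 0) := by
    simpa using (hl.const_div_atTop a).norm
  have error_tendsto : Tendsto (fun i => (∑' j : ℕ, 1 / ((j : ℝ) + 1) ^ 2) * ‖a / l i‖ ^ 2) F
      (𝓝 0) := by
    have := (step_tendsto.pow 2).const_mul (∑' j : ℕ, 1 / ((j : ℝ) + 1) ^ 2)
    rwa [zero_pow two_ne_zero, mul_zero] at this
  have exp_tendsto := (Complex.continuous_exp.tendsto _).comp (tendsto_exp_sub_one_mul_sub hl hm a)
  refine tendsto_of_tendsto_of_dist exp_tendsto (squeeze_zero' (.of_forall fun _ => dist_nonneg) ?_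
    error_tendsto)
  filter_upwards [step_tendsto.eventually_le_const zero_lt_one] with i hi
  have norm_sub_one_le := Real.norm_exp_I_mul_ofReal_sub_one_le (x := a / l i)
  have norm_phase : ‖Complex.exp (-(Complex.I * (a * l i / 2 : ℝ)))‖ = 1 := by
    rw [← mul_neg, ← Complex.ofReal_neg, Complex.norm_exp_I_mul_ofReal]
  rw [dist_comm, dist_eq_norm, Function.comp, sub_eq_add_neg _ (Complex.I * _), Complex.exp_add,
    ← sub_mul, norm_mul, norm_phase, mul_one]
  refine (norm_recordPgf_sub_exp_le _ (Complex.norm_exp_I_mul_ofReal _)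
    (norm_sub_one_le.trans hi)).trans ?_
  gcongr

end GeneratingFunctionLimit

section Scales

open Topology

/-- A scale tending to infinity so slowly that even its fourth power is negligible compared with
`√(log n)`, which is its fifth power. -/
noncomputable def slowScale (n : ℕ) : ℝ :=
  Real.log n ^ (1 / 10 : ℝ)

lemma slowScale_pow (n k : ℕ) : slowScale n ^ k = Real.log n ^ (k / 10 : ℝ) := by
  rw [slowScale, ← Real.rpow_mul_natCast (Real.log_natCast_nonneg n), one_div_mul_eq_div]

lemma slowScale_pow_five (n : ℕ) : slowScale n ^ 5 = √(Real.log n) := by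
  rw [slowScale_pow, Real.sqrt_eq_rpow]
  norm_num

lemma tendsto_sqrt_log : Tendsto (fun n : ℕ => √(Real.log n)) atTop atTop :=
  Real.tendsto_sqrt_atTop.comp (Real.tendsto_log_atTop.comp tendsto_natCast_atTop_atTop)

lemma tendsto_slowScale : Tendsto slowScale atTop atTop :=
  (tendsto_rpow_atTop (by norm_num)).comp (Real.tendsto_log_atTop.comp tendsto_natCast_atTop_atTop)

lemma isLittleO_slowScale_pow_sqrt (k : ℕ) :
    (fun n => slowScale n ^ k) =o[atTop] fun n : ℕ => √(n : ℝ) := by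
  simp_rw [slowScale_pow, Real.sqrt_eq_rpow]
  exact (isLittleO_log_rpow_rpow_atTop _ (by norm_num)).comp_tendsto tendsto_natCast_atTop_atTop

lemma eventually_slowScale_sq_le_sqrt : ∀ᶠ n : ℕ in atTop, slowScale n ^ 2 ≤ √(n : ℝ) := by
  filter_upwards [(isLittleO_slowScale_pow_sqrt 2).bound zero_lt_one] with n hn
  simpa [abs_of_nonneg (Real.sqrt_nonneg _)] using hn

/-- The number of initial positions, and of smallest values, whose records determine the limit
law. -/
noncomputable def innerCutoff (n : ℕ) : ℕ :=
  ⌊√(n : ℝ) / slowScale n⌋₊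

/-- With high probability all low records at positions and with values beyond the inner cutoff lie
in the square box of this side. -/
noncomputable def outerCutoff (n : ℕ) : ℕ :=
  ⌊√(n : ℝ) * slowScale n ^ 2⌋₊

lemma tendsto_sqrt_div_slowScale : Tendsto (fun n : ℕ => √(n : ℝ) / slowScale n) atTop atTop := by
  refine tendsto_atTop_mono' _ ?_ tendsto_slowScale
  filter_upwards [eventually_slowScale_sq_le_sqrt, tendsto_slowScale.eventually_gt_atTop 0]
    with n hn hB
  rwa [le_div_iff₀ hB, ← sq]

lemma tendsto_sqrt_mul_slowScale_sq :
    Tendsto (fun n : ℕ => √(n : ℝ) * slowScale n ^ 2) atTop atTop :=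
  (Real.tendsto_sqrt_atTop.comp tendsto_natCast_atTop_atTop).atTop_mul_atTop₀
    ((tendsto_pow_atTop two_ne_zero).comp tendsto_slowScale)

lemma innerCutoff_isEquivalent :
    (fun n => (innerCutoff n : ℝ)) ~[atTop] fun n : ℕ => √(n : ℝ) / slowScale n :=
  isEquivalent_nat_floor.comp_tendsto tendsto_sqrt_div_slowScale

lemma outerCutoff_isEquivalent :
    (fun n => (outerCutoff n : ℝ)) ~[atTop] fun n : ℕ => √(n : ℝ) * slowScale n ^ 2 :=
  isEquivalent_nat_floor.comp_tendsto tendsto_sqrt_mul_slowScale_sq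

lemma innerCutoff_isLittleO_outerCutoff :
    (fun n => (innerCutoff n : ℝ)) =o[atTop] fun n => (outerCutoff n : ℝ) := by
  refine innerCutoff_isEquivalent.trans_isLittleO
    (IsLittleO.trans_isEquivalent ?_ outerCutoff_isEquivalent.symm)
  simp_rw [div_eq_mul_inv]
  refine (isBigO_refl _ _).mul_isLittleO (IsLittleO.trans (g := fun _ => (1 : ℝ)) ?_ ?_)
  · exact (isLittleO_one_iff ℝ).2 (tendsto_inv_atTop_zero.comp tendsto_slowScale)
  · exact (isLittleO_const_left_of_ne one_ne_zero).2 (tendsto_norm_atTop_atTop.comp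
      ((tendsto_pow_atTop two_ne_zero).comp tendsto_slowScale))

lemma eventually_innerCutoff_pos : ∀ᶠ n in atTop, 0 < innerCutoff n :=
  (tendsto_nat_floor_atTop.comp tendsto_sqrt_div_slowScale).eventually_gt_atTop 0

lemma eventually_innerCutoff_lt_outerCutoff : ∀ᶠ n in atTop, innerCutoff n < outerCutoff n := by
  filter_upwards [innerCutoff_isLittleO_outerCutoff.bound one_half_pos,
    (tendsto_nat_floor_atTop.comp tendsto_sqrt_mul_slowScale_sq).eventually_gt_atTop 0] with n hn hL
  have outer_pos : (0 : ℝ) < outerCutoff n := Nat.cast_pos.2 hL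
  rw [Real.norm_natCast, Real.norm_natCast] at hn
  exact_mod_cast hn.trans_lt (mul_lt_of_lt_one_left outer_pos one_half_lt_one)

lemma eventually_outerCutoff_le : ∀ᶠ n in atTop, outerCutoff n ≤ n := by
  filter_upwards [eventually_slowScale_sq_le_sqrt] with n hn
  refine Nat.floor_le_of_le ?_
  calc √(n : ℝ) * slowScale n ^ 2 ≤ √(n : ℝ) * √(n : ℝ) := by gcongr
    _ = n := Real.mul_self_sqrt n.cast_nonneg

lemma eventually_innerCutoff_le : ∀ᶠ n in atTop, innerCutoff n ≤ n := by
  filter_upwards [eventually_innerCutoff_lt_outerCutoff, eventually_outerCutoff_le]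
    with n inner_lt outer_le
  exact inner_lt.le.trans outer_le

lemma tendsto_div_innerCutoff_mul_sub : Tendsto (fun n : ℕ =>
    (n : ℝ) / (innerCutoff n * (outerCutoff n - innerCutoff n))) atTop (𝓝 0) := by
  have gap : (fun n => (outerCutoff n : ℝ) - innerCutoff n) ~[atTop]
      fun n : ℕ => √(n : ℝ) * slowScale n ^ 2 :=
    outerCutoff_isEquivalent.sub_isLittleO
      (innerCutoff_isLittleO_outerCutoff.trans_isEquivalent outerCutoff_isEquivalent)
  refine ((IsEquivalent.refl (u := fun n : ℕ => (n : ℝ))).div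
    (innerCutoff_isEquivalent.mul gap)).symm.tendsto_nhds ?_
  refine (tendsto_inv_atTop_zero.comp tendsto_slowScale).congr' ?_
  filter_upwards [eventually_gt_atTop 0, tendsto_slowScale.eventually_gt_atTop 0] with n hn hB
  have n_pos : (0 : ℝ) < n := Nat.cast_pos.2 hn
  simp only [Function.comp_apply, Pi.div_apply, Pi.mul_apply]
  field_simp
  rw [Real.sq_sqrt n_pos.le]

lemma harmonic_innerCutoff_sub_isLittleO :
    (fun n : ℕ => (harmonic (innerCutoff n) : ℝ) - √(Real.log n) ^ 2 / 2) =o[atTop]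
      fun n : ℕ => √(Real.log n) := by
  have floor_error : (fun n : ℕ => (harmonic (innerCutoff n) : ℝ) -
      Real.log (√(n : ℝ) / slowScale n)) =O[atTop] fun _ => (1 : ℝ) := by
    refine IsBigO.of_bound 1 ?_
    filter_upwards [tendsto_sqrt_div_slowScale.eventually_ge_atTop 1] with n hn
    rw [norm_one, mul_one, innerCutoff, Real.norm_of_nonneg (sub_nonneg.2
      (log_le_harmonic_floor _ (zero_le_one.trans hn)))]
    exact sub_le_iff_le_add.2 (harmonic_floor_le_one_add_log _ hn)
  have log_slowScale : (fun n => Real.log (slowScale n)) =o[atTop] fun n : ℕ => √(Real.log n) := by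
    simp_rw [← slowScale_pow_five]
    simpa only [Function.comp_def, Real.rpow_ofNat] using
      (isLittleO_log_rpow_atTop (r := 5) (by norm_num)).comp_tendsto tendsto_slowScale
  refine ((floor_error.trans_isLittleO ?_).sub log_slowScale).congr' ?_ .rfl
  · exact (isLittleO_const_left_of_ne one_ne_zero).2
      (tendsto_norm_atTop_atTop.comp tendsto_sqrt_log)
  · filter_upwards [eventually_gt_atTop 0, tendsto_slowScale.eventually_gt_atTop 0] with n hn hB
    rw [Real.sq_sqrt (Real.log_natCast_nonneg n),
      Real.log_div (Real.sqrt_ne_zero'.2 (Nat.cast_pos.2 hn)) hB.ne', Real.log_sqrt n.cast_nonneg]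
    ring

lemma isBigO_inv_natCast_sub_one :
    (fun n : ℕ => ((n : ℝ) - 1)⁻¹) =O[atTop] fun n : ℕ => (n : ℝ)⁻¹ := by
  refine IsBigO.of_bound 2 ?_
  filter_upwards [eventually_ge_atTop 2] with n hn
  have two_le : (2 : ℝ) ≤ n := Nat.ofNat_le_cast.2 hn
  rw [Real.norm_of_nonneg (by rw [inv_nonneg]; linarith), Real.norm_of_nonneg (by positivity),
    inv_le_iff_one_le_mul₀ (by linarith)]
  field_simp
  linarith

variable {μ : (n : ℕ) → Measure (Equiv.Perm (Fin n))} [∀ n, IsProbabilityMeasure (μ n)]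
  [∀ n, SMulInvariantMeasure (ConjAct (Equiv.Perm (Fin n))) (Equiv.Perm (Fin n)) (μ n)]

lemma isBigO_integral_stayCount_below
    (hfix : (fun n => ∫ σ, (Fintype.card (Function.fixedPoints σ) : ℝ) ∂μ n) =O[atTop]
      fun n : ℕ => √(n : ℝ))
    {K : ℕ → ℕ} {y : ℕ → ℝ} (hKn : ∀ᶠ n in atTop, K n ≤ n)
    (hK : (fun n => (K n : ℝ)) =O[atTop] fun n => √(n : ℝ) * y n) :
    (fun n => ∫ σ, (stayCount (below n (K n)) σ : ℝ) ∂μ n) =O[atTop]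
      fun n => |y n| + y n ^ 2 := by
  have diagonal : (fun n => K n * ((∫ σ, (Fintype.card (Function.fixedPoints σ) : ℝ) ∂μ n) / n))
      =O[atTop] fun n => |y n| + y n ^ 2 := by
    refine (hK.mul (hfix.mul (isBigO_refl (fun n : ℕ => (n : ℝ)⁻¹) _))).trans (IsBigO.of_bound 1 ?_)
    filter_upwards [eventually_gt_atTop 0] with n hn
    have cancel : √(n : ℝ) * y n * (√(n : ℝ) * (n : ℝ)⁻¹) = y n := by
      rw [mul_mul_mul_comm, Real.mul_self_sqrt n.cast_nonneg]
      field_simp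
    rw [cancel, one_mul]
    exact (le_add_of_nonneg_right (sq_nonneg _)).trans (le_abs_self _)
  have off_diagonal : (fun n => (K n : ℝ) ^ 2 / (n - 1)) =O[atTop] fun n => |y n| + y n ^ 2 := by
    refine ((hK.pow 2).mul isBigO_inv_natCast_sub_one).trans (IsBigO.of_bound 1 ?_)
    filter_upwards [eventually_gt_atTop 0] with n hn
    have cancel : (√(n : ℝ) * y n) ^ 2 * (n : ℝ)⁻¹ = y n ^ 2 := by
      rw [mul_pow, Real.sq_sqrt n.cast_nonneg]
      field_simp
    rw [cancel, one_mul, Real.norm_of_nonneg (sq_nonneg _)]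
    exact (le_add_of_nonneg_left (abs_nonneg _)).trans (le_abs_self _)
  refine IsBigO.trans (IsBigO.of_bound 1 ?_) (diagonal.add off_diagonal)
  filter_upwards [hKn, eventually_gt_atTop 1] with n hn h1
  have bound := integral_stayCount_le (μ := μ n) (by rwa [Fintype.card_fin]) (below n (K n))
  rw [card_below hn, Fintype.card_fin] at bound
  rw [one_mul, Real.norm_of_nonneg (integral_nonneg fun _ => Nat.cast_nonneg _)]
  exact bound.trans (le_abs_self _)

lemma tendsto_integral_stayCount_innerCutoff
    (hfix : (fun n => ∫ σ, (Fintype.card (Function.fixedPoints σ) : ℝ) ∂μ n) =O[atTop]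
      fun n : ℕ => √(n : ℝ)) :
    Tendsto (fun n => ∫ σ, (stayCount (below n (innerCutoff n)) σ : ℝ) ∂μ n) atTop (𝓝 0) := by
  have inv_tendsto := tendsto_inv_atTop_zero.comp tendsto_slowScale
  refine (isBigO_integral_stayCount_below hfix eventually_innerCutoff_le
    (innerCutoff_isEquivalent.isBigO)).trans_tendsto ?_
  simpa using inv_tendsto.abs.add (inv_tendsto.pow 2)

lemma isLittleO_integral_stayCount_outerCutoff
    (hfix : (fun n => ∫ σ, (Fintype.card (Function.fixedPoints σ) : ℝ) ∂μ n) =O[atTop]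
      fun n : ℕ => √(n : ℝ)) :
    (fun n => ∫ σ, (stayCount (below n (outerCutoff n)) σ : ℝ) ∂μ n) =o[atTop]
      fun n : ℕ => √(Real.log n) := by
  refine (isBigO_integral_stayCount_below hfix eventually_outerCutoff_le
    outerCutoff_isEquivalent.isBigO).trans_isLittleO ?_
  simp_rw [← slowScale_pow_five, ← pow_mul]
  have pow_five {k : ℕ} (hk : k < 5) : (fun n => slowScale n ^ k) =o[atTop]
      fun n => slowScale n ^ 5 :=
    (isLittleO_pow_pow_atTop_of_lt hk).comp_tendsto tendsto_slowScale
  exact (pow_five (by norm_num)).norm_left.add (pow_five (by norm_num))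

end Scales

section AsymptoticComparison

open Topology

lemma smulInvariantMeasure_conjAct_map_pow {G : Type*} [Group G] [MeasurableSpace G]
    [DiscreteMeasurableSpace G] (ν : Measure G) [SMulInvariantMeasure (ConjAct G) G ν] (k : ℕ) :
    SMulInvariantMeasure (ConjAct G) G (ν.map (· ^ k)) := by
  have : MeasurableConstSMul (ConjAct G) G := ⟨fun _ => .of_discrete⟩
  exact smulInvariantMeasure_map ν _ (fun g a => (smul_pow' g a k).symm) .of_discrete

lemma card_fixedPoints_le_pow {V : Type*} [Fintype V] [DecidableEq V] (σ : Equiv.Perm V) (k : ℕ) :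
    Fintype.card (Function.fixedPoints σ) ≤ Fintype.card (Function.fixedPoints ⇑(σ ^ k)) :=
  Set.card_le_card fun _ hi => Function.IsFixedPt.perm_pow hi k

variable {μ : (n : ℕ) → Measure (Equiv.Perm (Fin n))} [∀ n, IsProbabilityMeasure (μ n)]

lemma isBigO_integral_card_fixedPoints_of_sq
    (hfix : (fun n => ∫ σ : Equiv.Perm (Fin n),
      (Fintype.card (Function.fixedPoints ⇑(σ ^ 2)) : ℝ) ∂μ n) =O[atTop] fun n : ℕ => √(n : ℝ)) :
    (fun n => ∫ σ, (Fintype.card (Function.fixedPoints σ) : ℝ) ∂μ n) =O[atTop]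
      fun n : ℕ => √(n : ℝ) := by
  refine IsBigO.trans (IsBigO.of_norm_le fun n => ?_) hfix
  rw [Real.norm_of_nonneg (integral_nonneg fun _ => Nat.cast_nonneg _)]
  exact integral_mono .of_finite .of_finite fun σ => Nat.cast_le.2 (card_fixedPoints_le_pow σ 2)

variable [∀ n, SMulInvariantMeasure (ConjAct (Equiv.Perm (Fin n))) (Equiv.Perm (Fin n)) (μ n)]

lemma tendsto_measureReal_compl_displacing_innerCutoff
    (hfix : (fun n => ∫ σ, (Fintype.card (Function.fixedPoints σ) : ℝ) ∂μ n) =O[atTop]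
      fun n : ℕ => √(n : ℝ)) :
    Tendsto (fun n => (μ n).real (displacing (below n (innerCutoff n) : Set (Fin n)))ᶜ) atTop
      (𝓝 0) :=
  squeeze_zero (fun _ => measureReal_nonneg) (fun _ => measureReal_compl_displacing_le _)
    (tendsto_integral_stayCount_innerCutoff hfix)

lemma tendsto_integral_pow_lrec_sub {S : (n : ℕ) → Set (Equiv.Perm (Fin n))}
    (hS : ∀ n, IsConjStable (below n (innerCutoff n) : Set (Fin n)) (S n))
    (hSm : ∀ n, S n ⊆ displacing (below n (innerCutoff n) : Set (Fin n)))
    (hSc : Tendsto (fun n => (μ n).real (S n)ᶜ) atTop (𝓝 0))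
    (hfix : (fun n => ∫ σ, (Fintype.card (Function.fixedPoints σ) : ℝ) ∂μ n) =O[atTop]
      fun n : ℕ => √(n : ℝ))
    {x Φ : ℕ → ℂ} (hx : ∀ n, ‖x n‖ = 1) (hΦ : ∀ n, ‖Φ n‖ ≤ 1)
    (hx1 : (fun n => x n - 1) =O[atTop] fun n : ℕ => (√(Real.log n))⁻¹)
    (hSΦ : ∀ n (h : innerCutoff n ≤ n), ∫ σ in S n, x n ^ ((leftMinima (σ ∘ Fin.castLE h)).card +
      (leftMinima (⇑σ⁻¹ ∘ Fin.castLE h)).card) ∂μ n = (μ n).real (S n) * Φ n) :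
    Tendsto (fun n => ∫ σ, x n ^ lrec σ ∂μ n - Φ n) atTop (𝓝 0) := by
  have rest : Tendsto (fun n => ‖x n - 1‖ *
      ∫ σ, (stayCount (below n (outerCutoff n)) σ : ℝ) ∂μ n) atTop (𝓝 0) := by
    refine (isLittleO_one_iff ℝ).1 ((hx1.norm_left.mul_isLittleO
      (isLittleO_integral_stayCount_outerCutoff hfix)).trans_isBigO (IsBigO.of_bound 1 ?_))
    refine .of_forall fun n => ?_
    rw [one_mul, norm_one, Real.norm_of_nonneg (by positivity)]
    exact inv_mul_le_one
  refine squeeze_zero_norm' ?_ (by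
    simpa using ((hSc.const_mul 2).add (tendsto_div_innerCutoff_mul_sub.const_mul 4)).add rest)
  filter_upwards [eventually_innerCutoff_le, eventually_innerCutoff_pos,
    eventually_innerCutoff_lt_outerCutoff, eventually_outerCutoff_le] with n inner_le inner_pos
    inner_lt outer_le
  exact norm_integral_pow_lrec_sub_le inner_le (hS n) (hSm n) inner_pos inner_lt outer_le (hx n)
    (hΦ n) (hSΦ n inner_le)

lemma tendsto_integral_pow_lrec_sub_recordPgf_sq
    (hfix : (fun n => ∫ σ, (Fintype.card (Function.fixedPoints σ) : ℝ) ∂μ n) =O[atTop]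
      fun n : ℕ => √(n : ℝ))
    (hμ : ∀ n, ∀ᵐ σ ∂μ n, σ ^ 2 = 1) {x : ℕ → ℂ} (hx : ∀ n, ‖x n‖ = 1)
    (hx1 : (fun n => x n - 1) =O[atTop] fun n : ℕ => (√(Real.log n))⁻¹) :
    Tendsto (fun n => ∫ σ, x n ^ lrec σ ∂μ n - recordPgf (innerCutoff n) (x n ^ 2)) atTop
      (𝓝 0) :=
  tendsto_integral_pow_lrec_sub (fun _ => isConjStable_displacing _) (fun _ => Set.Subset.rfl)
    (tendsto_measureReal_compl_displacing_innerCutoff hfix) hfix hx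
    (fun n => norm_recordPgf_le_one _ (by rw [norm_pow, hx, one_pow])) hx1
    fun n h => setIntegral_displacing_pow_of_sq_eq_one h (hμ n) (x n)

lemma tendsto_measureReal_compl_displacing_inter_pow
    (hfix : (fun n => ∫ σ : Equiv.Perm (Fin n),
      (Fintype.card (Function.fixedPoints ⇑(σ ^ 2)) : ℝ) ∂μ n) =O[atTop] fun n : ℕ => √(n : ℝ)) :
    Tendsto (fun n => (μ n).real (displacing (below n (innerCutoff n) : Set (Fin n)) ∩
      {σ | σ ^ 2 ∈ displacing (below n (innerCutoff n) : Set (Fin n))})ᶜ) atTop (𝓝 0) := by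
  have (n : ℕ) := smulInvariantMeasure_conjAct_map_pow (μ n) 2
  have (n : ℕ) : IsProbabilityMeasure ((μ n).map (· ^ 2)) :=
    Measure.isProbabilityMeasure_map Measurable.of_discrete.aemeasurable
  have square := tendsto_measureReal_compl_displacing_innerCutoff
    (μ := fun n => (μ n).map (· ^ 2)) (by
      simpa only [integral_map Measurable.of_discrete.aemeasurable
        Measurable.of_discrete.aestronglyMeasurable] using hfix)
  have base := tendsto_measureReal_compl_displacing_innerCutoff
    (isBigO_integral_card_fixedPoints_of_sq hfix)
  refine squeeze_zero (fun _ => measureReal_nonneg) (fun n => ?_) (by simpa using base.add square)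
  rw [Set.compl_inter, map_measureReal_apply .of_discrete .of_discrete]
  exact measureReal_union_le _ _

lemma tendsto_integral_pow_lrec_sub_sq_recordPgf
    (hfix : (fun n => ∫ σ : Equiv.Perm (Fin n),
      (Fintype.card (Function.fixedPoints ⇑(σ ^ 2)) : ℝ) ∂μ n) =O[atTop] fun n : ℕ => √(n : ℝ))
    {x : ℕ → ℂ} (hx : ∀ n, ‖x n‖ = 1)
    (hx1 : (fun n => x n - 1) =O[atTop] fun n : ℕ => (√(Real.log n))⁻¹) :
    Tendsto (fun n => ∫ σ, x n ^ lrec σ ∂μ n - recordPgf (innerCutoff n) (x n) ^ 2) atTop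
      (𝓝 0) := by
  have stable (n : ℕ) := isConjStable_displacing (below n (innerCutoff n) : Set (Fin n))
  refine tendsto_integral_pow_lrec_sub (fun n => (stable n).inter ((stable n).setOf_pow_mem 2))
    (fun _ => Set.inter_subset_left) (tendsto_measureReal_compl_displacing_inter_pow hfix)
    (isBigO_integral_card_fixedPoints_of_sq hfix) hx (fun n => ?_) hx1
    fun n h => setIntegral_displacing_inter_pow h (x n)
  rw [norm_pow]
  exact pow_le_one₀ (norm_nonneg _) (norm_recordPgf_le_one _ (hx n))

end AsymptoticComparison

section LimitLaw

open Topology NNReal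

lemma charFun_map_natCast_sub_sq_div {Ω : Type*} [MeasurableSpace Ω] {P : Measure Ω}
    {X : Ω → ℕ} (hX : AEMeasurable X P) (l θ : ℝ) :
    charFun (P.map fun ω => ((X ω : ℝ) - l ^ 2) / l) θ =
      (∫ ω, Complex.exp (Complex.I * (θ / l : ℝ)) ^ X ω ∂P) *
        Complex.exp (-(Complex.I * (θ * l : ℝ))) := by
  have hXl : AEMeasurable (fun ω => ((X ω : ℝ) - l ^ 2) / l) P :=
    (Measurable.of_discrete (f := fun k : ℕ => ((k : ℝ) - l ^ 2) / l)).comp_aemeasurable hX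
  rw [charFun_apply_real, integral_map hXl (by fun_prop), ← integral_mul_const]
  congr 1 with ω
  have l_sq_div : l ^ 2 / l = l := by rw [sq, mul_self_div_self]
  rw [← Complex.exp_nat_mul, ← Complex.exp_add, sub_div (X ω : ℝ), l_sq_div]
  congr 1
  push_cast
  ring

lemma tendstoInDistribution_natCast_sub_sq_div {Ω : ℕ → Type*} [∀ n, MeasurableSpace (Ω n)]
    {P : (n : ℕ) → Measure (Ω n)} [∀ n, IsProbabilityMeasure (P n)] {X : (n : ℕ) → Ω n → ℕ}
    (hX : ∀ n, AEMeasurable (X n) (P n)) (l : ℕ → ℝ) (v : ℝ≥0)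
    (h : ∀ θ : ℝ, Tendsto (fun n => (∫ ω, Complex.exp (Complex.I * (θ / l n : ℝ)) ^ X n ω ∂P n) *
      Complex.exp (-(Complex.I * (θ * l n : ℝ)))) atTop
        (𝓝 (Complex.exp (-((v * θ ^ 2 / 2 : ℝ) : ℂ))))) :
    TendstoInDistribution (fun n ω => ((X n ω : ℝ) - l n ^ 2) / l n) atTop (id : ℝ → ℝ) P
      (gaussianReal 0 v) := by
  refine ⟨fun n => (Measurable.of_discrete (f := fun k : ℕ =>
    ((k : ℝ) - l n ^ 2) / l n)).comp_aemeasurable (hX n), aemeasurable_id,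
    ProbabilityMeasure.tendsto_iff_tendsto_charFun.2 fun θ => ?_⟩
  simp only [ProbabilityMeasure.coe_mk, Measure.map_id, charFun_gaussianReal,
    charFun_map_natCast_sub_sq_div (hX _)]
  convert h θ using 3
  push_cast
  ring

lemma exp_I_mul_div_sqrt_log_sub_one_isBigO (θ : ℝ) :
    (fun n : ℕ => Complex.exp (Complex.I * (θ / √(Real.log n) : ℝ)) - 1) =O[atTop]
      fun n : ℕ => (√(Real.log n))⁻¹ := by
  refine IsBigO.of_bound |θ| (.of_forall fun n => ?_)
  refine (Real.norm_exp_I_mul_ofReal_sub_one_le).trans_eq ?_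
  rw [div_eq_mul_inv, norm_mul, Real.norm_eq_abs]

variable {Ω : ℕ → Type*} [∀ n, MeasurableSpace (Ω n)] {P : (n : ℕ) → Measure (Ω n)}
  [∀ n, IsProbabilityMeasure (P n)] {τ : (n : ℕ) → Ω n → Equiv.Perm (Fin n)}
  {μ : (n : ℕ) → Measure (Equiv.Perm (Fin n))}

lemma tendstoInDistribution_lrec (hτ : ∀ n, HasLaw (τ n) (μ n) (P n)) (v : ℝ≥0) (Φ : ℝ → ℕ → ℂ)
    (hμΦ : ∀ θ : ℝ, Tendsto (fun n : ℕ => ∫ σ, Complex.exp (Complex.I *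
      (θ / √(Real.log n) : ℝ)) ^ lrec σ ∂μ n - Φ θ n) atTop (𝓝 0))
    (hΦ : ∀ θ : ℝ, Tendsto (fun n : ℕ => Φ θ n *
      Complex.exp (-(Complex.I * (θ * √(Real.log n) : ℝ)))) atTop
        (𝓝 (Complex.exp (-((v * θ ^ 2 / 2 : ℝ) : ℂ))))) :
    TendstoInDistribution
      (fun (n : ℕ) (ω : Ω n) => ((lrec (τ n ω) : ℝ) - Real.log n) / √(Real.log n))
      atTop (id : ℝ → ℝ) P (gaussianReal 0 v) := by
  have in_law := tendstoInDistribution_natCast_sub_sq_div (P := P) (X := fun n ω => lrec (τ n ω))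
    (fun n => (Measurable.of_discrete (f := lrec)).comp_aemeasurable (hτ n).aemeasurable)
    (fun n => √(Real.log n)) v fun θ => ?_
  · simpa only [Real.sq_sqrt (Real.log_natCast_nonneg _)] using in_law
  have transfer (n : ℕ) : ∫ ω, Complex.exp (Complex.I * (θ / √(Real.log n) : ℝ)) ^ lrec (τ n ω)
      ∂P n = ∫ σ, Complex.exp (Complex.I * (θ / √(Real.log n) : ℝ)) ^ lrec σ ∂μ n :=
    (hτ n).integral_comp (f := fun σ => Complex.exp (Complex.I *
      (θ / √(Real.log n) : ℝ)) ^ lrec σ) Measurable.of_discrete.aestronglyMeasurable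
  simp only [transfer]
  have error : Tendsto (fun n : ℕ => (∫ σ, Complex.exp (Complex.I *
      (θ / √(Real.log n) : ℝ)) ^ lrec σ ∂μ n - Φ θ n) *
        Complex.exp (-(Complex.I * (θ * √(Real.log n) : ℝ)))) atTop (𝓝 0) := by
    refine (hμΦ θ).zero_mul_isBoundedUnder_le (isBoundedUnder_of ⟨1, fun n => le_of_eq ?_⟩)
    rw [Function.comp_apply, ← mul_neg, ← Complex.ofReal_neg, Complex.norm_exp_I_mul_ofReal]
  simpa only [sub_mul, sub_add_cancel, zero_add] using error.add (hΦ θ)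

variable [∀ n, IsProbabilityMeasure (μ n)]
  [∀ n, SMulInvariantMeasure (ConjAct (Equiv.Perm (Fin n))) (Equiv.Perm (Fin n)) (μ n)]

lemma tendstoInDistribution_lrec_of_sq_eq_one (hτ : ∀ n, HasLaw (τ n) (μ n) (P n))
    (hfix : (fun n => ∫ σ, (Fintype.card (Function.fixedPoints σ) : ℝ) ∂μ n) =O[atTop]
      fun n : ℕ => √(n : ℝ))
    (hμ : ∀ n, ∀ᵐ σ ∂μ n, σ ^ 2 = 1) :
    TendstoInDistribution
      (fun (n : ℕ) (ω : Ω n) => ((lrec (τ n ω) : ℝ) - Real.log n) / √(Real.log n))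
      atTop (id : ℝ → ℝ) P (gaussianReal 0 2) := by
  refine tendstoInDistribution_lrec hτ 2 _ (fun θ => tendsto_integral_pow_lrec_sub_recordPgf_sq
    hfix hμ (fun n => Complex.norm_exp_I_mul_ofReal _)
    (exp_I_mul_div_sqrt_log_sub_one_isBigO θ)) fun θ => ?_
  convert tendsto_recordPgf_mul_exp tendsto_sqrt_log harmonic_innerCutoff_sub_isLittleO (2 * θ)
    using 2 with n
  · rw [← Complex.exp_nat_mul]
    congr 2
    · congr 1
      push_cast
      ring
    · push_cast
      ring_nf
  · congr 1
    push_cast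
    ring

lemma tendstoInDistribution_lrec_of_fixedPoints_sq (hτ : ∀ n, HasLaw (τ n) (μ n) (P n))
    (hfix : (fun n => ∫ σ : Equiv.Perm (Fin n),
      (Fintype.card (Function.fixedPoints ⇑(σ ^ 2)) : ℝ) ∂μ n) =O[atTop] fun n : ℕ => √(n : ℝ)) :
    TendstoInDistribution
      (fun (n : ℕ) (ω : Ω n) => ((lrec (τ n ω) : ℝ) - Real.log n) / √(Real.log n))
      atTop (id : ℝ → ℝ) P (gaussianReal 0 1) := by
  refine tendstoInDistribution_lrec hτ 1 _ (fun θ => tendsto_integral_pow_lrec_sub_sq_recordPgf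
    hfix (fun n => Complex.norm_exp_I_mul_ofReal _)
    (exp_I_mul_div_sqrt_log_sub_one_isBigO θ)) fun θ => ?_
  convert (tendsto_recordPgf_mul_exp tendsto_sqrt_log harmonic_innerCutoff_sub_isLittleO θ).pow 2
    using 2 with n
  · rw [mul_pow, ← Complex.exp_nat_mul]
    congr 2
    push_cast
    ring
  · rw [← Complex.exp_nat_mul]
    congr 1
    push_cast
    ring

end LimitLaw

section CycleTypes

lemma smulInvariantMeasure_uniformOn {G α : Type*} [Group G] [MulAction G α] [MeasurableSpace α]
    [DiscreteMeasurableSpace α] {s : Set α} (hs : ∀ g : G, (g • ·) ⁻¹' s = s) :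
    SMulInvariantMeasure G α (uniformOn s) where
  measure_preimage_smul g u _ := by
    have preimage_inter : s ∩ (g • ·) ⁻¹' u = (g • ·) ⁻¹' (s ∩ u) := by
      rw [Set.preimage_inter, hs]
    rw [uniformOn, cond_apply .of_discrete, cond_apply .of_discrete, preimage_inter,
      Measure.count_apply (s := _ ⁻¹' _) .of_discrete,
      Measure.count_apply (s := s ∩ u) .of_discrete,
      Set.encard_preimage_of_bijective (MulAction.bijective g)]

lemma card_fixedPoints_sq_of_pow_three_eq_one {V : Type*} [Fintype V] [DecidableEq V]
    {σ : Equiv.Perm V} (hσ : σ ^ 3 = 1) :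
    Fintype.card (Function.fixedPoints ⇑(σ ^ 2)) = Fintype.card (Function.fixedPoints σ) := by
  refine le_antisymm ?_ (card_fixedPoints_le_pow σ 2)
  have sq_sq : (σ ^ 2) ^ 2 = σ := by rw [← pow_mul, pow_succ, hσ, one_mul]
  exact Set.card_le_card fun i hi => sq_sq ▸ Function.IsFixedPt.perm_pow hi 2

variable {n : ℕ} {t : n.Partition}

instance smulInvariantMeasure_uniformOn_cyclicPerms (t : n.Partition) :
    SMulInvariantMeasure (ConjAct (Equiv.Perm (Fin n))) (Equiv.Perm (Fin n))
      (uniformOn (cyclicPerms t)) := by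
  refine smulInvariantMeasure_uniformOn fun π => Set.ext fun σ => ?_
  have conj_partition : (π • σ).partition = σ.partition :=
    Equiv.Perm.partition_eq_of_isConj.1 (ConjAct.mem_orbit_conjAct.1 ⟨π, rfl⟩)
  rw [Set.mem_preimage, cyclicPerms, Set.mem_ofPred_eq, Set.mem_ofPred_eq, conj_partition]

lemma ae_uniformOn_mem_cyclicPerms (t : n.Partition) :
    ∀ᵐ σ ∂uniformOn (cyclicPerms t), σ ∈ cyclicPerms t :=
  ae_cond_mem .of_discrete

lemma card_fixedPoints_eq_numCycles {σ : Equiv.Perm (Fin n)} (hσ : σ ∈ cyclicPerms t) :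
    Fintype.card (Function.fixedPoints σ) = numCycles t 1 := by
  have one_notMem : 1 ∉ σ.cycleType := fun h => by
    simpa using Equiv.Perm.two_le_of_mem_cycleType h
  rw [numCycles, ← hσ.out, Equiv.Perm.parts_partition, Multiset.count_add,
    Multiset.count_replicate_self, Multiset.count_eq_zero_of_notMem one_notMem, zero_add,
    ← Equiv.Perm.sum_cycleType, Equiv.Perm.card_fixedPoints]

lemma eq_or_eq_of_mem_parts {a b q : ℕ} (hab : a ≠ b)
    (h : a * numCycles t a + b * numCycles t b = n) (hq : q ∈ t.parts) : q = a ∨ q = b := by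
  by_contra! hne
  set s := insert a (insert b t.parts.toFinset) with s_def
  have sum_le : ∑ i ∈ {q, a, b}, numCycles t i * i ≤ ∑ i ∈ s, numCycles t i * i :=
    Finset.sum_le_sum_of_subset (by simp [s_def, Finset.insert_subset_iff, hq])
  have sum_eq : ∑ i ∈ s, numCycles t i * i = n := by
    conv_rhs => rw [← t.parts_sum, Finset.sum_multiset_count_of_subset t.parts s fun i hi =>
      Finset.mem_insert_of_mem (Finset.mem_insert_of_mem hi)]
    rfl
  rw [sum_eq, Finset.sum_insert (by simp [hne]), Finset.sum_pair hab, mul_comm _ a, mul_comm _ b,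
    h] at sum_le
  have q_pos : 0 < numCycles t q * q :=
    Nat.mul_pos (Multiset.count_pos.2 hq) (t.parts_pos hq)
  omega

lemma pow_eq_one_of_mem_cyclicPerms {p : ℕ} (hp : 1 < p)
    (h : numCycles t 1 + p * numCycles t p = n) {σ : Equiv.Perm (Fin n)}
    (hσ : σ ∈ cyclicPerms t) : σ ^ p = 1 := by
  rw [← orderOf_dvd_iff_pow_eq_one, ← Equiv.Perm.lcm_cycleType, Multiset.lcm_dvd]
  intro q hq
  have q_mem : q ∈ t.parts := by
    rw [← hσ.out, Equiv.Perm.parts_partition]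
    exact Multiset.mem_add.2 (Or.inl hq)
  rcases eq_or_eq_of_mem_parts hp.ne (by rwa [one_mul]) q_mem with rfl | rfl
  · exact absurd (Equiv.Perm.two_le_of_mem_cycleType hq) (by norm_num)
  · exact dvd_rfl

lemma integral_card_fixedPoints_uniformOn [IsProbabilityMeasure (uniformOn (cyclicPerms t))] :
    ∫ σ, (Fintype.card (Function.fixedPoints σ) : ℝ) ∂uniformOn (cyclicPerms t) =
      numCycles t 1 := by
  rw [integral_congr_ae ((ae_uniformOn_mem_cyclicPerms t).mono fun σ hσ =>
    congrArg Nat.cast (card_fixedPoints_eq_numCycles hσ)), integral_const, probReal_univ, one_smul]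

lemma integral_card_fixedPoints_sq_uniformOn (h : numCycles t 1 + 3 * numCycles t 3 = n) :
    ∫ σ, (Fintype.card (Function.fixedPoints ⇑(σ ^ 2)) : ℝ) ∂uniformOn (cyclicPerms t) =
      ∫ σ, (Fintype.card (Function.fixedPoints σ) : ℝ) ∂uniformOn (cyclicPerms t) :=
  integral_congr_ae ((ae_uniformOn_mem_cyclicPerms t).mono fun _ hσ => congrArg Nat.cast
    (card_fixedPoints_sq_of_pow_three_eq_one
      (pow_eq_one_of_mem_cyclicPerms (by norm_num) h hσ)))

end CycleTypes

theorem mainTheorem6_general {Ω : ℕ → Type*} [∀ n, MeasurableSpace (Ω n)]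
    (P : (n : ℕ) → Measure (Ω n)) [∀ n, IsProbabilityMeasure (P n)]
    (μ : (n : ℕ) → Measure (Equiv.Perm (Fin n)))
    [∀ n, SMulInvariantMeasure (ConjAct (Equiv.Perm (Fin n))) (Equiv.Perm (Fin n)) (μ n)]
    (τ : (n : ℕ) → Ω n → Equiv.Perm (Fin n)) (hτ : ∀ n, HasLaw (τ n) (μ n) (P n)) :
    ((fun n => ∫ σ, (Fintype.card (Function.fixedPoints σ) : ℝ) ∂μ n) =O[atTop]
        (fun n : ℕ => √(n : ℝ)) → (∀ n, ∀ᵐ σ ∂μ n, σ ^ 2 = 1) →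
      TendstoInDistribution
        (fun (n : ℕ) (ω : Ω n) => ((lrec (τ n ω) : ℝ) - Real.log n) / √(Real.log n))
        atTop (id : ℝ → ℝ) P (gaussianReal 0 2)) ∧
    ((fun n => ∫ σ : Equiv.Perm (Fin n), (Fintype.card (Function.fixedPoints ⇑(σ ^ 2)) : ℝ) ∂μ n)
        =O[atTop] (fun n : ℕ => √(n : ℝ)) →
      TendstoInDistribution
        (fun (n : ℕ) (ω : Ω n) => ((lrec (τ n ω) : ℝ) - Real.log n) / √(Real.log n))
        atTop (id : ℝ → ℝ) P (gaussianReal 0 1)) := by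
  have (n : ℕ) : IsProbabilityMeasure (μ n) := (hτ n).isProbabilityMeasure_iff.1 inferInstance
  exact ⟨tendstoInDistribution_lrec_of_sq_eq_one hτ,
    tendstoInDistribution_lrec_of_fixedPoints_sq hτ⟩

theorem mainTheorem6
    (t : (n : ℕ) → n.Partition)
    (ht : (fun n : ℕ => (numCycles (t n) 1 : ℝ)) =O[atTop] (fun n : ℕ => Real.sqrt (n : ℝ)))
    {Ω : ℕ → Type*} [∀ n, MeasurableSpace (Ω n)]
    (P : (n : ℕ) → Measure (Ω n)) [∀ n, IsProbabilityMeasure (P n)]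
    (τ : (n : ℕ) → Ω n → Equiv.Perm (Fin n))
    (hτ : ∀ n, HasLaw (τ n) (uniformOn (cyclicPerms (t n))) (P n)) :
    ((∀ n, numCycles (t n) 1 + 2 * numCycles (t n) 2 = n) →
      TendstoInDistribution
        (fun (n : ℕ) (ω : Ω n) =>
          ((lrec (τ n ω) : ℝ) - Real.log (n : ℝ)) / Real.sqrt (Real.log (n : ℝ)))
        atTop (id : ℝ → ℝ) P (gaussianReal 0 2)) ∧
    ((∀ n, numCycles (t n) 1 + 3 * numCycles (t n) 3 = n) →
      TendstoInDistribution
        (fun (n : ℕ) (ω : Ω n) =>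
          ((lrec (τ n ω) : ℝ) - Real.log (n : ℝ)) / Real.sqrt (Real.log (n : ℝ)))
        atTop (id : ℝ → ℝ) P (gaussianReal 0 1)) := by
  have (n : ℕ) : IsProbabilityMeasure (uniformOn (cyclicPerms (t n))) :=
    (hτ n).isProbabilityMeasure_iff.1 inferInstance
  have limit_laws := mainTheorem6_general P _ τ hτ
  refine ⟨fun h2 => limit_laws.1 ?_ fun n => ?_, fun h3 => limit_laws.2 ?_⟩
  · simpa only [integral_card_fixedPoints_uniformOn] using ht
  · exact (ae_uniformOn_mem_cyclicPerms (t n)).mono fun _ =>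
      pow_eq_one_of_mem_cyclicPerms one_lt_two (h2 n)
  · simpa only [integral_card_fixedPoints_sq_uniformOn (h3 _),
      integral_card_fixedPoints_uniformOn] using ht
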